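/- **Setting.** A *2-dimensional polyhedral complex* $K$ has a graph as its 1-skeleton (loops and multiple edges are allowed), to which polygonal 2-cells are attached along closed edge paths of positive length. Write $VK$ for its set of vertices. $K$ is *locally finite away from the 0-skeleton* if every 1-cell is a face of at most finitely many 2-cells; vertices may have infinite degree. An action of a group $G$ on $K$ is by cellular automorphisms, and it is *cocompact* if there are finitely many $G$-orbits of cells. Cell stabilisers may be infinite. Cohomology is cellular with $\mathbb{Z}_2$-coefficients, and compact support means finite support. $K$ is *cohomologically planar* (CHomP) if the natural map $H^1_c(K;\mathbb{Z}_2)\to H^1(K;\mathbb{Z}_2)$ is zero, i.e. if every compactly supported 1-cocycle is a coboundary. For $b\subseteq VK$ let $b^*=VK\setminus b$ and let $\delta b$ be the set of edges with exactly one endpoint in $b$. Let $$\mathscr{B}K=\{b\subseteq VK : \delta b \text{ is finite}\},$$ a Boolean ring with unit $VK$, whose addition is symmetric difference and whose multiplication is intersection. A subset $\mathcal{E}\subseteq\mathscr{B}K$ is *nested* if it is closed under complements and, for all $b_1,b_2\in\mathcal{E}$, at least one of $b_1\cap b_2$, $b_1\cap b_2^*$, $b_1^*\cap b_2$, $b_1^*\cap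 b_2^*$ is empty. It is *$G$-finite* if it consists of finitely many $G$-orbits. **Theorem.** Let $K$ be a connected 2-dimensional polyhedral complex that is locally finite away from the 0-skeleton, and let a group $G$ act cocompactly on $K$. If $K$ is cohomologically planar, then there is a $G$-invariant, nested, $G$-finite subset $\mathcal{E}\subseteq\mathscr{B}K$ that generates $\mathscr{B}K$ as a (unital) Boolean ring. -/

import Mathlib

open scoped Pointwise

/-- A 2-dimensional polyhedral complex, given by its cells and their incidences.
`V` is the set of vertices, `D` the set of oriented edges, and `F` the set of 2-cells.
An undirected edge (1-cell) is a pair `{d, rev d}`; loops and multiple edges are allowed.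
Each 2-cell is a polygon, attached along a closed edge path `bd σ` of positive length, which is
recorded up to the choice of its starting point. -/
structure PolyComplex (V D F : Type*) where
  src : D → V
  rev : D → D
  rev_rev : ∀ d, rev (rev d) = d
  rev_ne : ∀ d, rev d ≠ d
  bd : F → Cycle D
  bd_ne_nil : ∀ σ, bd σ ≠ Cycle.nil
  bd_closed : ∀ σ, (bd σ).Chain (fun d e => src (rev d) = src e)

namespace PolyComplex

variable {V D F : Type*} (K : PolyComplex V D F)

/-- The terminal vertex of an oriented edge. -/
def tgt (d : D) : V := K.src (K.rev d)

/-- Two vertices joined by an edge. -/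
def Joined (u v : V) : Prop := ∃ d, K.src d = u ∧ K.tgt d = v

/-- The complex is non-empty and any two vertices are joined by an edge path. -/
def Connected : Prop := Nonempty V ∧ ∀ u v : V, Relation.ReflTransGen K.Joined u v

/-- Every 1-cell is a face of only finitely many 2-cells. -/
def LocallyFiniteAwayFromVertices : Prop :=
  ∀ d : D, {σ : F | d ∈ K.bd σ ∨ K.rev d ∈ K.bd σ}.Finite

/-- The group `G` acts by automorphisms of the complex: the actions on vertices and on oriented
edges preserve the incidences, and the boundary path of `g • σ` is the translate by `g` of that of
`σ`, up to the choice of its starting point and its direction. -/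
structure IsCellularAction (G : Type*) [Group G] [MulAction G V] [MulAction G D]
    [MulAction G F] : Prop where
  src_smul : ∀ (g : G) (d : D), K.src (g • d) = g • K.src d
  rev_smul : ∀ (g : G) (d : D), K.rev (g • d) = g • K.rev d
  bd_smul : ∀ (g : G) (σ : F),
    K.bd (g • σ) = (K.bd σ).map (fun d => g • d) ∨
    K.bd (g • σ) = ((K.bd σ).map (fun d => K.rev (g • d))).reverse

/-- The action has finitely many orbits of cells in each dimension. -/
structure IsCocompactAction (V D F G : Type*) [Group G] [MulAction G V] [MulAction G D]
    [MulAction G F] : Prop where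
  vertices : Finite (MulAction.orbitRel.Quotient G V)
  edges : Finite (MulAction.orbitRel.Quotient G D)
  faces : Finite (MulAction.orbitRel.Quotient G F)

/-! ### Cellular cohomology in degree one, with coefficients mod 2 -/

/-- The 1-cochains mod 2: functions on undirected edges. -/
def C1 : Submodule (ZMod 2) (D → ZMod 2) where
  carrier := {z | ∀ d, z (K.rev d) = z d}
  add_mem' := fun ha hb d => by simp [ha d, hb d]
  zero_mem' := fun _ => rfl
  smul_mem' := fun c z hz d => by simp [hz d]

/-- The coboundary of a 0-cochain. -/
def d0 : (V → ZMod 2) →ₗ[ZMod 2] K.C1 where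
  toFun f := ⟨fun d => f (K.src d) + f (K.tgt d), fun d => by
    simp [tgt, K.rev_rev, add_comm]⟩
  map_add' f g := by
    ext d
    simp only [Pi.add_apply, Submodule.coe_add]
    ring
  map_smul' c f := by
    ext d
    simp [mul_add]

theorem d0_apply (f : V → ZMod 2) (d : D) :
    (K.d0 f).1 d = f (K.src d) + f (K.tgt d) := rfl

/-- The coboundary of a 1-cochain: its sum along the boundary of each 2-cell. -/
def d1 : K.C1 →ₗ[ZMod 2] (F → ZMod 2) where
  toFun z σ := ((K.bd σ).toMultiset.map z.1).sum
  map_add' z w := by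
    ext σ
    simp [Multiset.sum_map_add]
  map_smul' c z := by
    ext σ
    simp [Multiset.sum_map_mul_left]

theorem d1_apply (z : K.C1) (σ : F) :
    K.d1 z σ = ((K.bd σ).toMultiset.map z.1).sum := rfl

theorem map_tgt_eq_map_src (l : List D) (a b : D)
    (h : List.IsChain (fun d e => K.src (K.rev d) = K.src e) (a :: (l ++ [b]))) :
    (a :: l).map K.tgt = (l ++ [b]).map K.src := by
  induction l generalizing a with
  | nil => simpa [tgt] using h
  | cons c l ih =>
    rw [List.cons_append, List.isChain_cons_cons] at h
    have := ih c h.2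
    simp only [List.map_cons, List.cons_append] at this ⊢
    rw [this]
    simp [tgt, h.1]

/-- The coboundary of a coboundary is zero. -/
theorem d1_d0 (f : V → ZMod 2) : K.d1 (K.d0 f) = 0 := by
  ext σ
  have hc := K.bd_closed σ
  change ((K.bd σ).toMultiset.map (fun d => f (K.src d) + f (K.tgt d))).sum = 0
  generalize K.bd σ = c at hc
  induction c using Quotient.inductionOn with
  | h l =>
    cases l with
    | nil => rfl
    | cons a l =>
      have h := K.map_tgt_eq_map_src l a a ((Cycle.chain_coe_cons _ a l).1 hc)
      have h2 : (Multiset.map (fun d => f (K.tgt d)) (↑(a :: l) : Multiset D)).sum =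
          (Multiset.map (fun d => f (K.src d)) (↑(a :: l) : Multiset D)).sum := by
        have h3 := congrArg (fun m : List V => (m.map f).sum) h
        simp only [List.map_map, Function.comp_def, List.map_cons, List.map_append,
          List.sum_cons, List.sum_append, List.map_nil, List.sum_nil] at h3
        simp only [Multiset.map_coe, Multiset.sum_coe, List.map_cons, List.sum_cons]
        rw [h3]
        ring
      change (Multiset.map _ (↑(a :: l) : Multiset D)).sum = 0
      rw [Multiset.sum_map_add, h2]
      exact CharTwo.add_self_eq_zero _

/-- The 1-cocycles. -/
def Z1 : Submodule (ZMod 2) K.C1 := LinearMap.ker K.d1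

/-- The 1-coboundaries. -/
def B1 : Submodule (ZMod 2) K.C1 := LinearMap.range K.d0

/-- The first cohomology group mod 2. -/
abbrev H1 : Type _ := K.Z1 ⧸ K.B1.submoduleOf K.Z1

/-- Functions to `ℤ/2` that vanish outside a finite set of cells. -/
def finSupp (A : Type*) : Submodule (ZMod 2) (A → ZMod 2) where
  carrier := {f | f.support.Finite}
  add_mem' := fun {a b} ha hb => (ha.union hb).subset (Function.support_add a b)
  zero_mem' := by simp
  smul_mem' := fun c f hf => Set.Finite.subset hf (Function.support_const_smul_subset c f)

/-- The 1-cochains of compact (that is, finite) support. -/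
def C1c : Submodule (ZMod 2) K.C1 := (finSupp D).comap K.C1.subtype

/-- The 1-cocycles of compact support. -/
def Z1c : Submodule (ZMod 2) K.C1 := K.Z1 ⊓ K.C1c

/-- The coboundaries in the complex of compactly supported cochains. As a vertex may lie on
infinitely many edges, this complex consists of the cochains of finite support whose coboundary
has finite support too. -/
def B1c : Submodule (ZMod 2) K.C1 := (finSupp V).map K.d0 ⊓ K.C1c

/-- The first cohomology group mod 2 with compact supports. -/
abbrev H1c : Type _ := K.Z1c ⧸ K.B1c.submoduleOf K.Z1c

theorem Z1c_le_Z1 : K.Z1c ≤ K.Z1 := inf_le_left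

theorem B1c_le_B1 : K.B1c ≤ K.B1 := by
  rintro _ ⟨⟨f, _, rfl⟩, _⟩
  exact ⟨f, rfl⟩

/-- The natural map from compactly supported cohomology to cohomology. -/
def H1cToH1 : K.H1c →ₗ[ZMod 2] K.H1 :=
  Submodule.mapQ (K.B1c.submoduleOf K.Z1c) (K.B1.submoduleOf K.Z1)
    (Submodule.inclusion K.Z1c_le_Z1) (fun _ hz => K.B1c_le_B1 hz)

/-- Cohomological planarity. -/
def CHomP : Prop := K.H1cToH1 = 0

/-- Cohomological planarity says that each compactly supported 1-cocycle is a coboundary. -/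
theorem cHomP_iff : K.CHomP ↔ ∀ z ∈ K.Z1c, z ∈ K.B1 := by
  constructor
  · intro h z hz
    have h1 : (K.B1.submoduleOf K.Z1).mkQ ⟨z, K.Z1c_le_Z1 hz⟩ = 0 :=
      LinearMap.congr_fun h (Submodule.Quotient.mk ⟨z, hz⟩)
    rw [Submodule.mkQ_apply, Submodule.Quotient.mk_eq_zero] at h1
    exact h1
  · intro h
    refine LinearMap.ext fun x => ?_
    obtain ⟨⟨z, hz⟩, rfl⟩ := Submodule.Quotient.mk_surjective _ x
    exact (Submodule.Quotient.mk_eq_zero _).2 (h z hz)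

/-! ### The Boolean ring of vertex sets with finite coboundary -/

/-- The coboundary of a set of vertices: the edges with exactly one endpoint in `b`, each of them
listed with both of its orientations. -/
def coboundary (b : Set V) : Set D := {d | ¬(K.src d ∈ b ↔ K.tgt d ∈ b)}

/-- The Boolean ring of all sets of vertices with finite coboundary. Its addition is symmetric
difference, its multiplication is intersection, and its unit is the set of all vertices. -/
def cutRing : Subring (AsBoolRing (Set V)) where
  carrier := {b | (K.coboundary (ofBoolRing b)).Finite}
  mul_mem' := fun {a b} ha hb => (ha.union hb).subset (by
    intro d hd
    simp only [coboundary, Set.mem_union, Set.mem_ofPred_eq, ofBoolRing_mul, Set.inf_eq_inter,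
      Set.mem_inter_iff] at hd ⊢
    tauto)
  one_mem' := by simp [coboundary]
  add_mem' := fun {a b} ha hb => (ha.union hb).subset (by
    intro d hd
    simp only [coboundary, Set.mem_union, Set.mem_ofPred_eq, ofBoolRing_add,
      Set.mem_symmDiff] at hd ⊢
    tauto)
  zero_mem' := by simp [coboundary]
  neg_mem' := fun {a} ha => by simpa using ha

end PolyComplex

/-- Two subsets are nested if at least one of the four corners is empty. -/
def NestedPair {V : Type*} (a b : Set V) : Prop :=
  a ∩ b = ∅ ∨ a ∩ bᶜ = ∅ ∨ aᶜ ∩ b = ∅ ∨ aᶜ ∩ bᶜ = ∅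

/-- A family of subsets is nested if it is closed under complements and its members are pairwise
nested. -/
def NestedFamily {V : Type*} (E : Set (Set V)) : Prop :=
  (∀ b ∈ E, bᶜ ∈ E) ∧ ∀ a ∈ E, ∀ b ∈ E, NestedPair a b

/-!
The complex `K` is first replaced by a triangulated graph on the same set of vertices
(`PolyComplex.triGraph`): any two vertices of a cell are joined by an edge belonging to that cell,
and any three vertices of a cell span a triangle. This changes neither the group action nor the
Boolean ring of sets with a finite cut. Cohomological planarity becomes the statement that every
union of components of a finite cut is again a cut, where two edges of a cut are adjacent if they
are sides of one triangle, possibly a degenerate one (`PolyComplex.splits_triGraph`).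

Call a set `b` *thin* if its cut is finite and of least size among those outside some additive
family, that is, some non-empty family closed under symmetric difference and complement. The cut of
a thin set is connected, since otherwise `b` would be a sum of two sets with smaller cuts
(`TriGraph.Thin.isTrack`). Joining the midpoints of the edges of such a cut by arcs across the
triangles gives a connected pattern, a *track* in the sense of Dunwoody. Only finitely many
tracks of bounded size pass through an edge, and tracks that do not meet are nested, so a
track crosses only finitely many tracks of bounded size.

Let `E` be a maximal invariant nested family of thin sets.

* *Accessibility* (`TriGraph.finite_orbits`): `E` has finitely many orbits. In fact, in any such
  family with bounded cuts each member `b` is outermost at some corner of a triangle; otherwise one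
  member `c` would be the next one after `b` at every edge of the cut of `b`, the cut of `b` would
  be a component of the connected cut of `c`, and `b` and `c` would agree up to complement. A corner
  has at most two outermost members, so the number of orbits is bounded in terms of the number of
  orbits of corners, whatever the bound on the cuts.
* *Generation* (`TriGraph.exists_nested_orbit`): `E` and the unit generate all sets with a finite
  cut, even additively. Otherwise consider the sets with a finite cut of least size outside the
  span. By submodularity of the size of cuts, one of them that crosses as few members of `E` as
  possible crosses none. Among those that are nested with `E`, one that crosses as few others of
  the same kind as possible is nested with its translates. So `E` was not maximal.
-/

/-! ### Nested pairs of sets -/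

theorem NestedPair.symm {V : Type*} {a b : Set V} (h : NestedPair a b) : NestedPair b a := by
  unfold NestedPair at *
  rw [Set.inter_comm b a, Set.inter_comm b aᶜ, Set.inter_comm bᶜ a, Set.inter_comm bᶜ aᶜ]
  tauto

theorem nestedPair_compl_right {V : Type*} {a b : Set V} : NestedPair a bᶜ ↔ NestedPair a b := by
  unfold NestedPair
  rw [compl_compl]
  tauto

theorem nestedPair_compl_left {V : Type*} {a b : Set V} : NestedPair aᶜ b ↔ NestedPair a b := by
  unfold NestedPair
  rw [compl_compl]
  tauto

theorem nestedPair_of_subset {V : Type*} {a b : Set V} (h : a ⊆ b) : NestedPair a b :=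
  .inr (.inl (Set.sdiff_eq_empty.2 h))

/-- A set nested with both members of a crossing pair is nested with each of its corners. -/
theorem NestedPair.inter {V : Type*} {d a b : Set V} (ha : NestedPair d a) (hb : NestedPair d b)
    (h : ¬NestedPair a b) : NestedPair d (a ∩ b) := by
  have h' : ∃ x, x ∉ a ∧ x ∉ b := by
    by_contra hcon
    push Not at hcon
    refine h (.inr (.inr (.inr ?_)))
    ext x
    simpa using hcon x
  obtain ⟨x, hxa, hxb⟩ := h'
  simp only [NestedPair, Set.eq_empty_iff_forall_notMem, Set.mem_inter_iff,
    Set.mem_compl_iff] at ha hb ⊢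
  grind

/-- A set nested with one member of a pair is nested with one of any two opposite corners. -/
theorem NestedPair.inter_or_inter_compl {V : Type*} {d a : Set V} (ha : NestedPair d a)
    (b : Set V) : NestedPair d (a ∩ b) ∨ NestedPair d (aᶜ ∩ bᶜ) := by
  simp only [NestedPair, Set.eq_empty_iff_forall_notMem, Set.mem_inter_iff,
    Set.mem_compl_iff] at ha ⊢
  grind

theorem nestedPair_smul {V G : Type*} [Group G] [MulAction G V] (g : G) {a b : Set V} :
    NestedPair (g • a) (g • b) ↔ NestedPair a b := by
  unfold NestedPair
  simp only [← Set.smul_set_compl, ← Set.smul_set_inter, Set.smul_set_eq_empty]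

/-- Two nested sets with a common point and a common non-point are comparable. -/
theorem NestedPair.subset_or_subset {V : Type*} {a b : Set V} (h : NestedPair a b) {u v : V}
    (hua : u ∈ a) (hub : u ∈ b) (hva : v ∉ a) (hvb : v ∉ b) : a ⊆ b ∨ b ⊆ a := by
  rcases h with h | h | h | h
  · exact absurd (show u ∈ a ∩ b from ⟨hua, hub⟩) (by simp [h])
  · exact .inl (Set.sdiff_eq_empty.1 h)
  · rw [Set.inter_comm] at h
    exact .inr (Set.sdiff_eq_empty.1 h)
  · exact absurd (show v ∈ aᶜ ∩ bᶜ from ⟨hva, hvb⟩) (by simp [h])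

/-! ### Additive families of sets -/

/-- A family of sets closed under symmetric difference and complement. If it is non-empty, it is an
additive subgroup of the Boolean ring of all sets that contains the unit. -/
structure AdditiveFamily {V : Type*} (R : Set (Set V)) : Prop where
  symmDiff_mem : ∀ a ∈ R, ∀ b ∈ R, symmDiff a b ∈ R
  compl_mem : ∀ a ∈ R, aᶜ ∈ R

namespace AdditiveFamily

variable {V : Type*} {R : Set (Set V)}

theorem compl_mem_iff (hR : AdditiveFamily R) {a : Set V} : aᶜ ∈ R ↔ a ∈ R :=
  ⟨fun h => by simpa using hR.compl_mem _ h, hR.compl_mem a⟩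

theorem mem_of_inter_mem (hR : AdditiveFamily R) {a b : Set V} (h₁ : a ∩ b ∈ R)
    (h₂ : a ∩ bᶜ ∈ R) : a ∈ R := by
  have h := hR.symmDiff_mem _ h₁ _ h₂
  rwa [show symmDiff (a ∩ b) (a ∩ bᶜ) = a by
    ext x; simp only [Set.mem_symmDiff, Set.mem_inter_iff, Set.mem_compl_iff]; tauto] at h

theorem compl_inter_mem (hR : AdditiveFamily R) {a b : Set V} (hb : b ∈ R) (h : aᶜ ∩ b ∈ R) :
    a ∩ b ∈ R := by
  have h' := hR.symmDiff_mem _ h _ hb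
  rwa [show symmDiff (aᶜ ∩ b) b = a ∩ b by
    ext x; simp only [Set.mem_symmDiff, Set.mem_inter_iff, Set.mem_compl_iff]; tauto] at h'

/-- If two sets lie outside an additive family, then so do two opposite corners of theirs. -/
theorem exists_opposite_corners (hR : AdditiveFamily R) {b c : Set V} (hb : b ∉ R) (hc : c ∉ R) :
    ∃ q, (q = c ∨ q = cᶜ) ∧ b ∩ q ∉ R ∧ bᶜ ∩ qᶜ ∉ R := by
  by_contra! hcon
  have h₁ := hcon c (.inl rfl)
  have h₂ := hcon cᶜ (.inr rfl)
  rw [compl_compl] at h₂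
  have hb' : bᶜ ∉ R := fun h => hb (hR.compl_mem_iff.1 h)
  have hc' : cᶜ ∉ R := fun h => hc (hR.compl_mem_iff.1 h)
  have k₁ : b ∩ c ∈ R → b ∩ cᶜ ∈ R → False := fun h h' => hb (hR.mem_of_inter_mem h h')
  have k₂ : bᶜ ∩ c ∈ R → bᶜ ∩ cᶜ ∈ R → False := fun h h' => hb' (hR.mem_of_inter_mem h h')
  have k₃ : b ∩ c ∈ R → bᶜ ∩ c ∈ R → False := fun h h' =>
    hc (hR.mem_of_inter_mem (b := b) (by rwa [Set.inter_comm]) (by rwa [Set.inter_comm]))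
  have k₄ : b ∩ cᶜ ∈ R → bᶜ ∩ cᶜ ∈ R → False := fun h h' =>
    hc' (hR.mem_of_inter_mem (b := b) (by rwa [Set.inter_comm]) (by rwa [Set.inter_comm]))
  tauto

end AdditiveFamily

/-- The smallest additive family that contains `E`. -/
def additiveSpan {V : Type*} (E : Set (Set V)) : Set (Set V) :=
  {b | ∀ R : Set (Set V), AdditiveFamily R → E ⊆ R → b ∈ R}

theorem additiveFamily_additiveSpan {V : Type*} (E : Set (Set V)) :
    AdditiveFamily (additiveSpan E) where
  symmDiff_mem _ ha _ hb R hR hE := hR.symmDiff_mem _ (ha R hR hE) _ (hb R hR hE)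
  compl_mem _ ha R hR hE := hR.compl_mem _ (ha R hR hE)

theorem subset_additiveSpan {V : Type*} (E : Set (Set V)) : E ⊆ additiveSpan E :=
  fun _ hb _ _ hE => hE hb

theorem additiveSpan_subset {V : Type*} {E R : Set (Set V)} (hR : AdditiveFamily R)
    (hE : E ⊆ R) : additiveSpan E ⊆ R :=
  fun _ hb => hb R hR hE

theorem smul_mem_additiveSpan {V G : Type*} [Group G] [MulAction G V] {E : Set (Set V)}
    (hE : ∀ g : G, ∀ b ∈ E, g • b ∈ E) (g : G) {b : Set V} (hb : b ∈ additiveSpan E) :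
    g • b ∈ additiveSpan E := by
  have hS := additiveFamily_additiveSpan E
  refine hb {c | g • c ∈ additiveSpan E} ⟨fun a ha b hb => ?_, fun a ha => ?_⟩
    fun c hc => subset_additiveSpan E (hE g c hc)
  · simpa only [Set.mem_ofPred_eq, Set.smul_set_symmDiff] using hS.symmDiff_mem _ ha _ hb
  · simpa only [Set.mem_ofPred_eq, Set.smul_set_compl] using hS.compl_mem _ ha

theorem Set.Nonempty.exists_forall_le_nat {α : Type*} {S : Set α} (hS : S.Nonempty) (f : α → ℕ) :
    ∃ a ∈ S, ∀ x ∈ S, f a ≤ f x := by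
  obtain ⟨a, ha, h⟩ := (measure f).wf.has_min S hS
  exact ⟨a, ha, fun x hx => not_lt.1 (h x hx)⟩

/-! ### Triangulated graphs and their cuts -/

/-- A connected graph on `V` with triangles, recorded through the relation `rel` of being two
sides of a triangle. The edges are oriented, and are the elements of the set `edges`; related
edges either are the two orientations of an edge, or have the same source and are completed to a
triangle by a third edge. The triangle may be degenerate: the third edge of two parallel edges is a
loop. -/
structure TriGraph (V X : Type*) where
  edges : Set X
  s : X → V
  t : X → V
  rel : X → X → Prop
  rel_refl : ∀ x ∈ edges, rel x x
  rel_cases : ∀ x ∈ edges, ∀ y ∈ edges, rel x y →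
    (s x = t y ∧ t x = s y) ∨ (s x = s y ∧ ∃ z ∈ edges, s z = t x ∧ t z = t y)
  finite_rel : ∀ x ∈ edges, {y ∈ edges | rel x y}.Finite
  connected : ∀ b : Set V, (∀ x ∈ edges, s x ∈ b ↔ t x ∈ b) → b = ∅ ∨ b = Set.univ

namespace TriGraph

variable {V X : Type*} (Γ : TriGraph V X)

/-- The edges separated by `b`. -/
def cut (b : Set V) : Set X := {x ∈ Γ.edges | ¬(Γ.s x ∈ b ↔ Γ.t x ∈ b)}

/-- The edges separated by `b` are linked to each other by triangles: in the geometric picture,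
the pattern that the cut draws on the triangles is connected. -/
def IsTrack (b : Set V) : Prop :=
  ∀ A ⊆ Γ.cut b, A.Nonempty → (∀ x ∈ A, ∀ y ∈ Γ.cut b, Γ.rel x y → y ∈ A) → A = Γ.cut b

/-- A thin set has a finite cut, of least size among the sets with a finite cut outside some
non-empty additive family `H`. As `H` contains the empty set and the whole set, a thin set is
neither. -/
def Thin (b : Set V) : Prop :=
  (Γ.cut b).Finite ∧ ∃ H : Set (Set V), AdditiveFamily H ∧ H.Nonempty ∧ b ∉ H ∧
    ∀ a, (Γ.cut a).Finite → a ∉ H → (Γ.cut b).ncard ≤ (Γ.cut a).ncard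

/-- Every union of components of a finite cut is a cut. -/
def Splits : Prop :=
  ∀ b, (Γ.cut b).Finite → ∀ A ⊆ Γ.cut b,
    (∀ x ∈ A, ∀ y ∈ Γ.cut b, Γ.rel x y → y ∈ A) → ∃ a, Γ.cut a = A

variable {Γ}

theorem cut_compl (b : Set V) : Γ.cut bᶜ = Γ.cut b := by
  ext x; simp only [cut, Set.mem_ofPred_eq, Set.mem_compl_iff]; tauto

theorem cut_symmDiff (a b : Set V) : Γ.cut (symmDiff a b) = symmDiff (Γ.cut a) (Γ.cut b) := by
  ext x; simp only [cut, Set.mem_ofPred_eq, Set.mem_symmDiff]; tauto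

theorem cut_inter_subset (a b : Set V) : Γ.cut (a ∩ b) ⊆ Γ.cut a ∪ Γ.cut b := by
  intro x; simp only [cut, Set.mem_ofPred_eq, Set.mem_union, Set.mem_inter_iff]; tauto

theorem finite_cut_inter {a b : Set V} (ha : (Γ.cut a).Finite) (hb : (Γ.cut b).Finite) :
    (Γ.cut (a ∩ b)).Finite :=
  (ha.union hb).subset (cut_inter_subset a b)

theorem eq_empty_or_univ_of_cut_eq_empty {b : Set V} (h : Γ.cut b = ∅) :
    b = ∅ ∨ b = Set.univ := by
  refine Γ.connected b fun x hx => ?_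
  by_contra hcon
  exact (Set.eq_empty_iff_forall_notMem.1 h) x ⟨hx, hcon⟩

theorem eq_or_eq_compl_of_cut_eq {a b : Set V} (h : Γ.cut a = Γ.cut b) : a = b ∨ a = bᶜ := by
  have h' : Γ.cut (symmDiff a b) = ∅ := by rw [cut_symmDiff, h, symmDiff_self]; rfl
  rcases eq_empty_or_univ_of_cut_eq_empty h' with h₁ | h₁
  · exact .inl (symmDiff_eq_bot.1 h₁)
  · exact .inr ((symmDiff_eq_top _ _).1 h₁).eq_compl

/-- Submodularity of the size of cuts, for two opposite corners. -/
theorem ncard_cut_inter_add_le {a b : Set V} (ha : (Γ.cut a).Finite) (hb : (Γ.cut b).Finite) :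
    (Γ.cut (a ∩ b)).ncard + (Γ.cut (aᶜ ∩ bᶜ)).ncard ≤ (Γ.cut a).ncard + (Γ.cut b).ncard := by
  have ha' : (Γ.cut aᶜ).Finite := by rwa [cut_compl]
  have hb' : (Γ.cut bᶜ).Finite := by rwa [cut_compl]
  rw [← Set.ncard_union_add_ncard_inter _ _ (finite_cut_inter ha hb) (finite_cut_inter ha' hb'),
    ← Set.ncard_union_add_ncard_inter _ _ ha hb]
  refine add_le_add (Set.ncard_le_ncard ?_ (ha.union hb))
    (Set.ncard_le_ncard ?_ (ha.inter_of_left _))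
  · intro x; simp only [cut, Set.mem_ofPred_eq, Set.mem_union, Set.mem_inter_iff,
      Set.mem_compl_iff]; tauto
  · intro x; simp only [cut, Set.mem_ofPred_eq, Set.mem_inter_iff, Set.mem_compl_iff]; tauto

/-! ### Thin sets and tracks -/

theorem Thin.finite {b : Set V} (h : Γ.Thin b) : (Γ.cut b).Finite := h.1

theorem Thin.compl {b : Set V} (h : Γ.Thin b) : Γ.Thin bᶜ := by
  obtain ⟨hf, H, hH, hne, hb, hmin⟩ := h
  rw [Thin, cut_compl]
  exact ⟨hf, H, hH, hne, fun h => hb (hH.compl_mem_iff.1 h), hmin⟩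

theorem Thin.isTrack (hΓ : Γ.Splits) {b : Set V} (h : Γ.Thin b) : Γ.IsTrack b := by
  obtain ⟨hf, H, hH, -, hb, hmin⟩ := h
  intro A hA hne hcl
  by_contra hcon
  -- otherwise `A` and its complement in `cut b` are smaller cuts, and `b` is a sum of two sets
  -- with these cuts
  obtain ⟨a, rfl⟩ := hΓ b hf A hA hcl
  have h₁ : a ∈ H := by
    by_contra ha
    exact absurd (Set.ncard_lt_ncard (hA.ssubset_of_ne hcon) hf)
      (not_lt.2 (hmin a (hf.subset hA) ha))
  have hsd : Γ.cut (symmDiff a b) = Γ.cut b \ Γ.cut a := by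
    rw [cut_symmDiff, Set.symmDiff_def, Set.sdiff_eq_empty.2 hA, Set.empty_union]
  have h₂ : symmDiff a b ∈ H := by
    by_contra ha
    refine absurd (Set.ncard_lt_ncard ?_ hf) (not_lt.2 (hmin _ (hsd ▸ hf.sdiff) ha))
    rw [hsd]
    obtain ⟨x, hx⟩ := hne
    exact ⟨Set.sdiff_subset, fun h => (h (hA hx)).2 hx⟩
  exact hb (by simpa using hH.symmDiff_mem _ h₁ _ h₂)

theorem Thin.ne_empty_ne_univ {b : Set V} (h : Γ.Thin b) : b ≠ ∅ ∧ b ≠ Set.univ := by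
  obtain ⟨-, H, hH, ⟨a, ha⟩, hb, -⟩ := h
  have h0 : (∅ : Set V) ∈ H := by simpa using hH.symmDiff_mem a ha a ha
  refine ⟨fun h => hb (h ▸ h0), fun h => hb (h ▸ ?_)⟩
  simpa using hH.compl_mem _ h0

theorem Thin.cut_nonempty {b : Set V} (h : Γ.Thin b) : (Γ.cut b).Nonempty := by
  by_contra hcon
  have := eq_empty_or_univ_of_cut_eq_empty (Set.not_nonempty_iff_eq_empty.1 hcon)
  have := h.ne_empty_ne_univ
  tauto

/-- The set of edges at distance at most `n` from `x`, where related edges are at distance one. -/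
def ball (Γ : TriGraph V X) (x : X) : ℕ → Set X
  | 0 => {x}
  | n + 1 => ball Γ x n ∪ ⋃ y ∈ ball Γ x n ∩ Γ.edges, {z ∈ Γ.edges | Γ.rel y z}

theorem finite_ball (x : X) (n : ℕ) : (Γ.ball x n).Finite := by
  induction n with
  | zero => exact Set.finite_singleton x
  | succ n ih =>
    exact ih.union ((ih.inter_of_left _).biUnion fun y hy => Γ.finite_rel y hy.2)

theorem IsTrack.lt_ncard_or_subset_ball {b : Set V} (hb : Γ.IsTrack b) (hf : (Γ.cut b).Finite)
    {x : X} (hx : x ∈ Γ.cut b) (n : ℕ) :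
    n < (Γ.cut b ∩ Γ.ball x n).ncard ∨ Γ.cut b ⊆ Γ.ball x n := by
  induction n with
  | zero =>
    left
    rw [Set.ncard_pos (hf.inter_of_left _)]
    exact ⟨x, hx, rfl⟩
  | succ n ih =>
    have hsub : Γ.ball x n ⊆ Γ.ball x (n + 1) := Set.subset_union_left
    rcases ih with ih | ih
    · by_cases heq : Γ.cut b ∩ Γ.ball x n = Γ.cut b ∩ Γ.ball x (n + 1)
      · right
        have hne : (Γ.cut b ∩ Γ.ball x n).Nonempty := by
          rw [← Set.ncard_pos (hf.inter_of_left _)]; omega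
        refine fun y hy => hsub ?_
        have := hb _ Set.inter_subset_left hne fun y hy z hz hyz => by
          rw [heq]
          refine ⟨hz, .inr ?_⟩
          exact Set.mem_biUnion (show y ∈ Γ.ball x n ∩ Γ.edges from ⟨hy.2, hy.1.1⟩) ⟨hz.1, hyz⟩
        rw [← this] at hy
        exact hy.2
      · left
        have := Set.ncard_lt_ncard ((Set.inter_subset_inter_right _ hsub).ssubset_of_ne heq)
          (hf.inter_of_left _)
        omega
    · exact .inr (ih.trans hsub)

/-- Only finitely many tracks of bounded size pass through a given edge. -/
theorem finite_isTrack_mem_cut (x : X) (n : ℕ) :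
    {b | Γ.IsTrack b ∧ (Γ.cut b).Finite ∧ (Γ.cut b).ncard ≤ n ∧ x ∈ Γ.cut b}.Finite := by
  have hfib : ∀ A : Set X, {b | Γ.cut b = A}.Finite := by
    intro A
    rcases Set.eq_empty_or_nonempty {b | Γ.cut b = A} with h | ⟨c, hc⟩
    · rw [h]; exact Set.finite_empty
    · refine (Set.toFinite {c, cᶜ}).subset fun b hb => ?_
      exact eq_or_eq_compl_of_cut_eq (hb.trans hc.symm)
  refine ((finite_ball (Γ := Γ) x n).powerset.biUnion fun A _ => hfib A).subset ?_
  rintro b ⟨hb, hf, hn, hx⟩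
  refine Set.mem_biUnion (x := Γ.cut b) ?_ rfl
  rcases hb.lt_ncard_or_subset_ball hf hx n with h | h
  · have := Set.ncard_le_ncard (Set.inter_subset_left (s := Γ.cut b) (t := Γ.ball x n)) hf
    omega
  · exact h

/-- The cut of a track that misses the cut of `b` lies on one side of `b`. -/
theorem IsTrack.one_side {b c : Set V} (hc : Γ.IsTrack c) (h : Disjoint (Γ.cut b) (Γ.cut c)) :
    (∀ x ∈ Γ.cut c, Γ.s x ∈ b ∧ Γ.t x ∈ b) ∨ (∀ x ∈ Γ.cut c, Γ.s x ∉ b ∧ Γ.t x ∉ b) := by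
  have hnot : ∀ x ∈ Γ.cut c, Γ.s x ∈ b ↔ Γ.t x ∈ b := fun x hx => by
    by_contra hcon
    exact Set.disjoint_left.1 h ⟨hx.1, hcon⟩ hx
  rcases Set.eq_empty_or_nonempty {x ∈ Γ.cut c | Γ.s x ∈ b} with h₁ | h₁
  · right
    intro x hx
    have : Γ.s x ∉ b := fun hs => (Set.eq_empty_iff_forall_notMem.1 h₁) x ⟨hx, hs⟩
    exact ⟨this, fun ht => this ((hnot x hx).2 ht)⟩
  · left
    have key := hc {x ∈ Γ.cut c | Γ.s x ∈ b} (Set.sep_subset _ _) h₁ fun x hx y hy hxy => by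
      refine ⟨hy, ?_⟩
      have h₂ := hnot x hx.1
      have h₃ := hnot y hy
      have h₄ := hx.2
      rcases Γ.rel_cases x hx.1.1 y hy.1 hxy with ⟨e₁, e₂⟩ | ⟨e, -⟩
      · rw [e₁] at h₄; exact h₃.2 h₄
      · rwa [e] at h₄
    intro x hx
    have hs : Γ.s x ∈ b := (key.ge hx).2
    exact ⟨hs, (hnot x hx).1 hs⟩

/-- Two tracks whose cuts are disjoint are nested: the corner opposite to the sides that contain
the cuts has an empty cut. -/
theorem IsTrack.nestedPair {b c : Set V} (hb : Γ.IsTrack b) (hc : Γ.IsTrack c)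
    (h : Disjoint (Γ.cut b) (Γ.cut c)) : NestedPair b c := by
  have key : ∀ p q : Set V, Γ.cut p = Γ.cut b → Γ.cut q = Γ.cut c →
      (∀ x ∈ Γ.cut c, Γ.s x ∈ p ∧ Γ.t x ∈ p) → (∀ x ∈ Γ.cut b, Γ.s x ∈ q ∧ Γ.t x ∈ q) →
      NestedPair p q := by
    intro p q hp hq h₁ h₂
    have h0 : Γ.cut (pᶜ ∩ qᶜ) = ∅ := by
      refine Set.eq_empty_iff_forall_notMem.2 fun x hx => ?_
      rcases cut_inter_subset _ _ hx with hx' | hx'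
      · rw [cut_compl, hp] at hx'
        have := h₂ x hx'
        exact hx.2 (by simp [this.1, this.2])
      · rw [cut_compl, hq] at hx'
        have := h₁ x hx'
        exact hx.2 (by simp [this.1, this.2])
    rcases eq_empty_or_univ_of_cut_eq_empty h0 with h3 | h3
    · exact .inr (.inr (.inr h3))
    · refine .inl (Set.eq_empty_iff_forall_notMem.2 fun x hx => ?_)
      have : x ∈ pᶜ ∩ qᶜ := h3 ▸ Set.mem_univ x
      exact this.1 hx.1
  rcases hc.one_side h with h₁ | h₁ <;> rcases hb.one_side h.symm with h₂ | h₂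
  · exact key b c rfl rfl h₁ h₂
  · exact nestedPair_compl_right.1 (key b cᶜ rfl (cut_compl c) h₁ h₂)
  · exact nestedPair_compl_left.1 (key bᶜ c (cut_compl b) rfl h₁ h₂)
  · exact nestedPair_compl_left.1 (nestedPair_compl_right.1
      (key bᶜ cᶜ (cut_compl b) (cut_compl c) h₁ h₂))

/-- A track crosses only finitely many tracks of bounded size. -/
theorem IsTrack.finite_crossing {b : Set V} (hb : Γ.IsTrack b) (hf : (Γ.cut b).Finite)
    {S : Set (Set V)} {n : ℕ}
    (hS : ∀ c ∈ S, Γ.IsTrack c ∧ (Γ.cut c).Finite ∧ (Γ.cut c).ncard ≤ n) :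
    {c ∈ S | ¬NestedPair c b}.Finite := by
  refine (hf.biUnion fun x _ => finite_isTrack_mem_cut (Γ := Γ) x n).subset ?_
  rintro c ⟨hc, hcb⟩
  obtain ⟨h₁, h₂, h₃⟩ := hS c hc
  obtain ⟨x, hx, hx'⟩ : ∃ x ∈ Γ.cut c, x ∈ Γ.cut b := by
    by_contra! hcon
    exact hcb (h₁.nestedPair hb (Set.disjoint_left.2 hcon))
  exact Set.mem_biUnion hx' ⟨h₁, h₂, h₃, hx⟩

end TriGraph

namespace TriGraph

variable {V X : Type*} {Γ : TriGraph V X} {G : Type*} [Group G] [MulAction G V] [MulAction G X]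

/-! ### Group actions on triangulated graphs -/

/-- The group acts by automorphisms, with finitely many orbits of related pairs of edges. -/
structure IsCocompact (Γ : TriGraph V X) (G : Type*) [Group G] [MulAction G V]
    [MulAction G X] : Prop where
  s_smul : ∀ (g : G) (x : X), Γ.s (g • x) = g • Γ.s x
  t_smul : ∀ (g : G) (x : X), Γ.t (g • x) = g • Γ.t x
  smul_mem_edges : ∀ (g : G), ∀ x ∈ Γ.edges, g • x ∈ Γ.edges
  finite_pairs : ∃ P : Set (X × X), P.Finite ∧
    ∀ x ∈ Γ.edges, ∀ y ∈ Γ.edges, Γ.rel x y → ∃ g : G, (g • x, g • y) ∈ P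

theorem IsCocompact.smul_mem_cut (hG : Γ.IsCocompact G) (g : G) {b : Set V} {x : X}
    (hx : x ∈ Γ.cut b) : g • x ∈ Γ.cut (g • b) := by
  refine ⟨hG.smul_mem_edges g x hx.1, ?_⟩
  rw [hG.s_smul, hG.t_smul, Set.smul_mem_smul_set_iff, Set.smul_mem_smul_set_iff]
  exact hx.2

theorem IsCocompact.cut_smul (hG : Γ.IsCocompact G) (g : G) (b : Set V) :
    Γ.cut (g • b) = g • Γ.cut b := by
  refine Set.Subset.antisymm (fun x hx => ?_) ?_
  · rw [Set.mem_smul_set_iff_inv_smul_mem]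
    simpa using hG.smul_mem_cut g⁻¹ hx
  · rintro _ ⟨x, hx, rfl⟩
    exact hG.smul_mem_cut g hx

theorem IsCocompact.ncard_cut_smul (hG : Γ.IsCocompact G) (g : G) (b : Set V) :
    (Γ.cut (g • b)).ncard = (Γ.cut b).ncard := by
  rw [hG.cut_smul]
  exact Set.ncard_image_of_injective _ (MulAction.injective g)

theorem IsCocompact.finite_cut_smul (hG : Γ.IsCocompact G) (g : G) {b : Set V} :
    (Γ.cut (g • b)).Finite ↔ (Γ.cut b).Finite := by
  rw [hG.cut_smul, Set.finite_smul_set]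

theorem Thin.smul (hG : Γ.IsCocompact G) (g : G) {b : Set V} (h : Γ.Thin b) :
    Γ.Thin (g • b) := by
  obtain ⟨hf, H, hH, ⟨a₀, ha₀⟩, hb, hmin⟩ := h
  refine ⟨(hG.finite_cut_smul g).2 hf, {a | g⁻¹ • a ∈ H}, ⟨fun a ha c hc => ?_, fun a ha => ?_⟩,
    ⟨g • a₀, by simpa using ha₀⟩, by simpa using hb, fun a ha haH => ?_⟩
  · simpa only [Set.mem_ofPred_eq, Set.smul_set_symmDiff] using hH.symmDiff_mem _ ha _ hc
  · simpa only [Set.mem_ofPred_eq, Set.smul_set_compl] using hH.compl_mem _ ha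
  · rw [hG.ncard_cut_smul, ← hG.ncard_cut_smul g⁻¹ a]
    exact hmin _ ((hG.finite_cut_smul _).2 ha) haH

/-! ### Enlarging a nested family -/

/-- If a thin set `e` lies in an additive family `R` and `b` does not, then some corner of `b` and
`e` lies outside `R` and has a cut that is no larger than that of `b`. -/
theorem Thin.exists_corner {R : Set (Set V)} (hR : AdditiveFamily R) {b e : Set V}
    (hbf : (Γ.cut b).Finite) (hb : b ∉ R)
    (he : Γ.Thin e) (heR : e ∈ R) :
    ∃ p q, (p = b ∨ p = bᶜ) ∧ (q = e ∨ q = eᶜ) ∧ p ∩ q ∉ R ∧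
      (Γ.cut (p ∩ q)).ncard ≤ (Γ.cut b).ncard := by
  have hbf' : (Γ.cut bᶜ).Finite := by rwa [cut_compl]
  have key : ∀ f, Γ.Thin f → f ∈ R → b ∩ f ∉ R → ∃ p, (p = b ∨ p = bᶜ) ∧ p ∩ f ∉ R ∧
      (Γ.cut (p ∩ f)).ncard ≤ (Γ.cut b).ncard := by
    intro f hf hfR h₁
    have h₂ : bᶜ ∩ f ∉ R := fun h => h₁ (hR.compl_inter_mem hfR h)
    have hff := hf.finite
    have hff' := hf.compl.finite
    have s₁ := ncard_cut_inter_add_le hbf hff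
    have s₂ := ncard_cut_inter_add_le hbf' hff
    rw [compl_compl, cut_compl] at s₂
    -- one of the two corners of `b` in the complement of `f` has a cut at least that of `f`
    obtain ⟨-, H, hH, -, hfH, hfmin⟩ := hf
    have : b ∩ fᶜ ∉ H ∨ bᶜ ∩ fᶜ ∉ H := by
      by_contra! hcon
      refine hfH (hH.compl_mem_iff.1 (hH.mem_of_inter_mem (b := b) ?_ ?_))
      · rw [Set.inter_comm]; exact hcon.1
      · rw [Set.inter_comm]; exact hcon.2
    rcases this with h | h
    · have := hfmin _ (finite_cut_inter hbf hff') h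
      exact ⟨bᶜ, .inr rfl, h₂, by omega⟩
    · have := hfmin _ (finite_cut_inter hbf' hff') h
      exact ⟨b, .inl rfl, h₁, by omega⟩
  by_cases h : b ∩ e ∈ R
  · obtain ⟨p, hp, h₁, h₂⟩ := key eᶜ he.compl (hR.compl_mem _ heR)
      fun h' => hb (hR.mem_of_inter_mem h h')
    exact ⟨p, eᶜ, hp, .inr rfl, h₁, h₂⟩
  · obtain ⟨p, hp, h₁, h₂⟩ := key e he heR h
    exact ⟨p, e, hp, .inl rfl, h₁, h₂⟩

theorem nestedPair_iff_of_eq_or {a p c : Set V} (h : p = a ∨ p = aᶜ) :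
    NestedPair c p ↔ NestedPair c a := by
  rcases h with rfl | rfl
  · rfl
  · exact nestedPair_compl_right

/-- If a nested family of thin sets of bounded size does not generate all finite cuts, then some
set with a finite cut of least size outside its span is nested with the family: one that crosses
as few members as possible. -/
theorem exists_minimal_nested (hΓ : Γ.Splits) {E : Set (Set V)} {n : ℕ}
    (hthin : ∀ e ∈ E, Γ.Thin e) (hn : ∀ e ∈ E, (Γ.cut e).ncard ≤ n)
    (hnest : ∀ a ∈ E, ∀ b ∈ E, NestedPair a b)
    {R : Set (Set V)} (hR : AdditiveFamily R) (hRne : R.Nonempty) (hER : E ⊆ R)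
    (hex : ∃ b, (Γ.cut b).Finite ∧ b ∉ R) :
    ∃ b, (Γ.cut b).Finite ∧ b ∉ R ∧
      (∀ a, (Γ.cut a).Finite → a ∉ R → (Γ.cut b).ncard ≤ (Γ.cut a).ncard) ∧
      ∀ e ∈ E, NestedPair e b := by
  obtain ⟨b₀, ⟨hb₀, hb₀R⟩, hmin₀⟩ :=
    Set.Nonempty.exists_forall_le_nat (S := {b | (Γ.cut b).Finite ∧ b ∉ R}) hex
      fun b => (Γ.cut b).ncard
  obtain ⟨b, ⟨hbf, hbR, hmin⟩, hcross⟩ :=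
    Set.Nonempty.exists_forall_le_nat (S := {b | (Γ.cut b).Finite ∧ b ∉ R ∧
      ∀ a, (Γ.cut a).Finite → a ∉ R → (Γ.cut b).ncard ≤ (Γ.cut a).ncard})
      ⟨b₀, hb₀, hb₀R, fun a ha haR => hmin₀ a ⟨ha, haR⟩⟩
      fun b => {c ∈ E | ¬NestedPair c b}.ncard
  refine ⟨b, hbf, hbR, hmin, fun e he => ?_⟩
  by_contra heb
  obtain ⟨p, q, hp, hq, hpq, hle⟩ := (hthin e he).exists_corner hR hbf hbR (hER he)
  have hpf : (Γ.cut p).Finite := by rcases hp with rfl | rfl <;> simpa [cut_compl] using hbf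
  have hqf : (Γ.cut q).Finite := by
    rcases hq with rfl | rfl <;> simpa [cut_compl] using (hthin _ he).finite
  have hpqcross : ¬NestedPair p q := fun h => heb <| by
    rw [nestedPair_iff_of_eq_or hq] at h
    rw [← nestedPair_iff_of_eq_or hp]
    exact h.symm
  refine absurd (hcross (p ∩ q) ⟨finite_cut_inter hpf hqf, hpq,
    fun a ha haR => hle.trans (hmin a ha haR)⟩) (not_le.2 ?_)
  have hthinb : Γ.Thin b := ⟨hbf, R, hR, hRne, hbR, hmin⟩
  refine Set.ncard_lt_ncard (Set.ssubset_iff_subset_ne.2 ⟨fun c hc => ⟨hc.1, fun hcb => hc.2 ?_⟩,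
    fun heq => ?_⟩) ((hthinb.isTrack hΓ).finite_crossing hbf
      fun c hc => ⟨(hthin c hc).isTrack hΓ, (hthin c hc).finite, hn c hc⟩)
  · exact NestedPair.inter ((nestedPair_iff_of_eq_or hp).2 hcb)
      ((nestedPair_iff_of_eq_or hq).2 (hnest c hc.1 e he)) hpqcross
  · have h₁ : e ∈ {c ∈ E | ¬NestedPair c (p ∩ q)} := heq ▸ ⟨he, heb⟩
    exact h₁.2 ((nestedPair_iff_of_eq_or hq).1 (nestedPair_of_subset Set.inter_subset_right)).symm

/-- Among the sets of least cut outside `R` that are nested with `E`, those crossing the fewest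
others of their kind are nested with each other: uncrossing two of them would give two sets with
fewer crossings in total. -/
theorem exists_nested_orbit (hΓ : Γ.Splits) (hG : Γ.IsCocompact G) {E : Set (Set V)} {n : ℕ}
    (hinv : ∀ g : G, ∀ b ∈ E, g • b ∈ E)
    (hthin : ∀ e ∈ E, Γ.Thin e) (hn : ∀ e ∈ E, (Γ.cut e).ncard ≤ n)
    (hnest : ∀ a ∈ E, ∀ b ∈ E, NestedPair a b)
    {R : Set (Set V)} (hR : AdditiveFamily R) (hRne : R.Nonempty) (hER : E ⊆ R)
    (hRinv : ∀ g : G, ∀ b ∈ R, g • b ∈ R)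
    (hex : ∃ b, (Γ.cut b).Finite ∧ b ∉ R) :
    ∃ b, Γ.Thin b ∧ b ∉ R ∧ (∀ e ∈ E, NestedPair e b) ∧ ∀ g : G, NestedPair b (g • b) := by
  obtain ⟨b₀, hb₀f, hb₀R, hmin, hb₀E⟩ :=
    exists_minimal_nested hΓ hthin hn hnest hR hRne hER hex
  set N := (Γ.cut b₀).ncard
  set S : Set (Set V) :=
    {b | (Γ.cut b).Finite ∧ b ∉ R ∧ (Γ.cut b).ncard ≤ N ∧ ∀ e ∈ E, NestedPair e b}
  have hSthin : ∀ b ∈ S, Γ.Thin b := fun b hb =>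
    ⟨hb.1, R, hR, hRne, hb.2.1, fun a ha haR => hb.2.2.1.trans (hmin a ha haR)⟩
  have hSinv : ∀ g : G, ∀ b ∈ S, g • b ∈ S := by
    rintro g b ⟨h₁, h₂, h₃, h₄⟩
    refine ⟨(hG.finite_cut_smul g).2 h₁, fun h => h₂ ?_, (hG.ncard_cut_smul g b).trans_le h₃,
      fun e he => ?_⟩
    · simpa using hRinv g⁻¹ _ h
    · rw [← nestedPair_smul g⁻¹, inv_smul_smul]
      exact h₄ _ (hinv _ _ he)
  set m : Set V → ℕ := fun b => {c ∈ S | ¬NestedPair c b}.ncard with hm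
  have hfin : ∀ b ∈ S, {c ∈ S | ¬NestedPair c b}.Finite := fun b hb =>
    ((hSthin b hb).isTrack hΓ).finite_crossing hb.1
      fun c hc => ⟨(hSthin c hc).isTrack hΓ, hc.1, hc.2.2.1⟩
  have hminv : ∀ (g : G) (b : Set V), m (g • b) = m b := by
    intro g b
    simp only [hm]
    rw [← Set.ncard_image_of_injective {c ∈ S | ¬NestedPair c b} (MulAction.injective g)]
    congr 1
    ext c
    constructor
    · rintro ⟨h₁, h₂⟩
      refine ⟨g⁻¹ • c, ⟨hSinv _ _ h₁, ?_⟩, smul_inv_smul g c⟩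
      rwa [← nestedPair_smul g, smul_inv_smul]
    · rintro ⟨c, ⟨h₁, h₂⟩, rfl⟩
      exact ⟨hSinv _ _ h₁, fun h => h₂ ((nestedPair_smul g).1 h)⟩
  obtain ⟨b, hb, hbmin⟩ := Set.Nonempty.exists_forall_le_nat (S := S)
    ⟨b₀, hb₀f, hb₀R, le_rfl, hb₀E⟩ m
  refine ⟨b, hSthin b hb, hb.2.1, hb.2.2.2, fun g => ?_⟩
  by_contra hcross
  have hc : g • b ∈ S := hSinv g b hb
  have hmc : m (g • b) = m b := hminv g b
  generalize g • b = c at hcross hc hmc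
  obtain ⟨q, hq, h₁, h₂⟩ := hR.exists_opposite_corners hb.2.1 hc.2.1
  have hqf : (Γ.cut q).Finite := by rcases hq with rfl | rfl <;> simpa [cut_compl] using hc.1
  have hqN : (Γ.cut q).ncard ≤ N := by
    rcases hq with rfl | rfl
    · exact hc.2.2.1
    · rw [cut_compl]; exact hc.2.2.1
  have hbq : ¬NestedPair b q := fun h => hcross ((nestedPair_iff_of_eq_or hq).1 h)
  have hbq' : ¬NestedPair bᶜ qᶜ := fun h =>
    hbq (nestedPair_compl_left.1 (nestedPair_compl_right.1 h))
  have hbf' : (Γ.cut bᶜ).Finite := by rw [cut_compl]; exact hb.1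
  have hqf' : (Γ.cut qᶜ).Finite := by rwa [cut_compl]
  have hsub := ncard_cut_inter_add_le hb.1 hqf
  have hbN := hb.2.2.1
  have hsize₁ := hmin _ (finite_cut_inter hb.1 hqf) h₁
  have hsize₂ := hmin _ (finite_cut_inter hbf' hqf') h₂
  have hqE : ∀ e ∈ E, NestedPair e q := fun e he =>
    (nestedPair_iff_of_eq_or hq).2 (hc.2.2.2 e he)
  have hP : b ∩ q ∈ S := ⟨finite_cut_inter hb.1 hqf, h₁, by omega,
    fun e he => (hb.2.2.2 e he).inter (hqE e he) hbq⟩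
  have hQ : bᶜ ∩ qᶜ ∈ S := ⟨finite_cut_inter hbf' hqf', h₂, by omega,
    fun e he => (nestedPair_compl_right.2 (hb.2.2.2 e he)).inter
      (nestedPair_compl_right.2 (hqE e he)) hbq'⟩
  have hlt : m (b ∩ q) + m (bᶜ ∩ qᶜ) < m b + m c := by
    simp only [hm]
    rw [← Set.ncard_union_add_ncard_inter _ _ (hfin _ hP) (hfin _ hQ),
      ← Set.ncard_union_add_ncard_inter _ _ (hfin _ hb) (hfin _ hc)]
    refine add_lt_add_of_lt_of_le (Set.ncard_lt_ncard (Set.ssubset_iff_subset_ne.2 ⟨?_, ?_⟩)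
      ((hfin _ hb).union (hfin _ hc))) (Set.ncard_le_ncard ?_ ((hfin _ hb).inter_of_left _))
    · intro d hd
      have hdS : d ∈ S := hd.elim (·.1) (·.1)
      by_contra hcon
      have hdb : NestedPair d b := by
        by_contra h; exact hcon (.inl ⟨hdS, h⟩)
      have hdq : NestedPair d q := (nestedPair_iff_of_eq_or hq).2 <| by
        by_contra h; exact hcon (.inr ⟨hdS, h⟩)
      rcases hd with hd | hd
      · exact hd.2 (hdb.inter hdq hbq)
      · exact hd.2 ((nestedPair_compl_right.2 hdb).inter (nestedPair_compl_right.2 hdq) hbq')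
    · intro heq
      -- `b` crosses `c`, but neither of the two corners
      rcases heq.ge (.inr ⟨hb, hcross⟩) with h | h
      · exact h.2 (nestedPair_of_subset Set.inter_subset_left).symm
      · exact h.2 (nestedPair_compl_right.1 (nestedPair_of_subset Set.inter_subset_left)).symm
    · rintro d ⟨hd₁, hd₂⟩
      refine ⟨⟨hd₁.1, fun h => ?_⟩, ⟨hd₁.1, fun h => ?_⟩⟩
      · exact (h.inter_or_inter_compl q).elim hd₁.2 hd₂.2
      · have h' := ((nestedPair_iff_of_eq_or hq).2 h).inter_or_inter_compl b
        rw [Set.inter_comm q, Set.inter_comm qᶜ] at h'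
        exact h'.elim hd₁.2 hd₂.2
  have := hbmin _ hP
  have := hbmin _ hQ
  omega

/-! ### Accessibility -/

theorem mem_cut_of_subset_of_subset {y : X} {b c d : Set V} (hbc : b ⊆ c) (hcd : c ⊆ d)
    (hyb : y ∈ Γ.cut b) (hyd : y ∈ Γ.cut d) : y ∈ Γ.cut c := by
  refine ⟨hyb.1, ?_⟩
  have h₁ := hyb.2
  have h₂ := hyd.2
  grind

/-- Each member `b` of a nested family of tracks of bounded size is the outermost one at some
corner of a triangle. Otherwise the members that follow `b` at the edges of its cut all coincide,
with one `c` say; then the cut of `b` is a component of the cut of `c`, so the cuts agree. -/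
theorem exists_pair_outermost {E : Set (Set V)} {n : ℕ}
    (htrack : ∀ b ∈ E, Γ.IsTrack b ∧ (Γ.cut b).Finite ∧ (Γ.cut b).Nonempty ∧ (Γ.cut b).ncard ≤ n)
    (hnest : ∀ a ∈ E, ∀ b ∈ E, NestedPair a b) {b : Set V} (hb : b ∈ E) :
    ∃ x ∈ Γ.cut b, ∃ y ∈ Γ.cut b, Γ.rel x y ∧
      ∀ c ∈ E, b ⊂ c → ¬(x ∈ Γ.cut c ∧ y ∈ Γ.cut c) := by
  by_contra! hcon
  obtain ⟨hbt, hbf, ⟨x₀, hx₀⟩, -⟩ := htrack b hb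
  let above : X → Set (Set V) := fun x => {c ∈ E | b ⊂ c ∧ x ∈ Γ.cut c}
  have hfin : (above x₀).Finite := (finite_isTrack_mem_cut (Γ := Γ) x₀ n).subset
    fun c hc => ⟨(htrack c hc.1).1, (htrack c hc.1).2.1, (htrack c hc.1).2.2.2, hc.2.2⟩
  -- members above `b` that are cut by the same edge form a chain
  have hchain : ∀ x ∈ Γ.cut b, ∀ c ∈ above x, ∀ d ∈ above x, c ⊆ d ∨ d ⊆ c := by
    rintro x hx c ⟨hc, hbc, hxc⟩ d ⟨hd, hbd, hxd⟩
    have h₁ := hx.2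
    have h₂ := hxc.2
    have h₃ := hxd.2
    have h₄ := @hbc.1
    have h₅ := @hbd.1
    by_cases hs : Γ.s x ∈ b
    · have ht : Γ.t x ∉ b := by tauto
      exact (hnest c hc d hd).subset_or_subset (h₄ hs) (h₅ hs)
        (fun h => h₂ ⟨fun _ => h, fun _ => h₄ hs⟩) (fun h => h₃ ⟨fun _ => h, fun _ => h₅ hs⟩)
    · have ht : Γ.t x ∈ b := by tauto
      exact (hnest c hc d hd).subset_or_subset (h₄ ht) (h₅ ht)
        (fun h => h₂ ⟨fun _ => h₄ ht, fun _ => h⟩) (fun h => h₃ ⟨fun _ => h₅ ht, fun _ => h⟩)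
  obtain ⟨c₀, hc₀E, hbc₀, hxc₀, -⟩ := hcon x₀ hx₀ x₀ hx₀ (Γ.rel_refl x₀ hx₀.1)
  obtain ⟨c, hc⟩ := hfin.exists_minimal ⟨c₀, hc₀E, hbc₀, hxc₀⟩
  have hleast : ∀ d ∈ above x₀, c ⊆ d := fun d hd =>
    (hchain x₀ hx₀ c hc.prop d hd).elim id fun h => hc.le_of_le hd h
  -- the edges at which `c` is the next member after `b`
  obtain ⟨hcE, hbc, -⟩ := hc.prop
  have hall := hbt {x ∈ Γ.cut b | x ∈ Γ.cut c ∧ ∀ d ∈ above x, c ⊆ d} (Set.sep_subset _ _)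
    ⟨x₀, hx₀, hc.prop.2.2, hleast⟩ <| by
    rintro x ⟨hx, hxc, hxl⟩ y hy hxy
    obtain ⟨d, hdE, hbd, hxd, hyd⟩ := hcon x hx y hy hxy
    have hcd : c ⊆ d := hxl d ⟨hdE, hbd, hxd⟩
    have hyc : y ∈ Γ.cut c := mem_cut_of_subset_of_subset hbc.le hcd hy hyd
    refine ⟨hy, hyc, fun e he => (hchain y hy c ⟨hcE, hbc, hyc⟩ e he).elim id fun hec => ?_⟩
    exact hxl e ⟨he.1, he.2.1, mem_cut_of_subset_of_subset he.2.1.le hec hx hxc⟩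
  have hsub : Γ.cut b ⊆ Γ.cut c := fun x hx => (hall.ge hx).2.1
  -- a triangle with two sides in `cut c`, one of them in `cut b`, has the other in `cut b` too,
  -- as its third side is not in `cut c`
  have heq := (htrack c hcE).1 (Γ.cut b) hsub ⟨x₀, hx₀⟩ fun x hx y hy hxy => by
    have hxc := (hsub hx).2
    have hx' := hx.2
    have hyc := hy.2
    refine ⟨hy.1, ?_⟩
    rcases Γ.rel_cases x hx.1 y hy.1 hxy with ⟨e₁, e₂⟩ | ⟨e₁, z, hz, hz₁, hz₂⟩
    · rw [e₁, e₂] at hx'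
      exact fun h => hx' h.symm
    · intro hyb
      have hzb : z ∈ Γ.cut b := ⟨hz, by rw [hz₁, hz₂]; rw [e₁] at hx'; tauto⟩
      have hzc := (hsub hzb).2
      rw [hz₁, hz₂] at hzc
      rw [e₁] at hxc
      tauto
  have hx₀b : Γ.s x₀ ∈ b ∨ Γ.t x₀ ∈ b := by have := hx₀.2; tauto
  rcases eq_or_eq_compl_of_cut_eq heq with h | h
  · exact hbc.ne h
  · rcases hx₀b with h' | h'
    · exact (h.le h') (hbc.le h')
    · exact (h.le h') (hbc.le h')

/-- A family as in `exists_pair_outermost` that is invariant has boundedly many orbits, since a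
corner of a triangle determines its outermost members up to the side they lie on. The bound
depends on the number of orbits of corners only, and not on the sizes of the cuts. -/
theorem encard_orbits_le {E : Set (Set V)} {n : ℕ} (hinv : ∀ g : G, ∀ b ∈ E, g • b ∈ E)
    (hG : Γ.IsCocompact G)
    (htrack : ∀ b ∈ E, Γ.IsTrack b ∧ (Γ.cut b).Finite ∧ (Γ.cut b).Nonempty ∧ (Γ.cut b).ncard ≤ n)
    (hnest : ∀ a ∈ E, ∀ b ∈ E, NestedPair a b) {P : Set (X × X)}
    (hP : ∀ x ∈ Γ.edges, ∀ y ∈ Γ.edges, Γ.rel x y → ∃ g : G, (g • x, g • y) ∈ P) :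
    ((fun b : Set V => MulAction.orbit G b) '' E).encard ≤
      (P ×ˢ (Set.univ : Set Prop)).encard := by
  let outer : X × X → Set V → Prop := fun p b => p.1 ∈ Γ.cut b ∧ p.2 ∈ Γ.cut b ∧
    ∀ c ∈ E, b ⊂ c → ¬(p.1 ∈ Γ.cut c ∧ p.2 ∈ Γ.cut c)
  let T : Set (Set V) := {b ∈ E | ∃ p ∈ P, outer p b}
  have hT : (fun b : Set V => MulAction.orbit G b) '' E ⊆
      (fun b : Set V => MulAction.orbit G b) '' T := by
    rintro _ ⟨b, hb, rfl⟩
    obtain ⟨x, hx, y, hy, hxy, hout⟩ := exists_pair_outermost htrack hnest hb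
    obtain ⟨g, hg⟩ := hP x hx.1 y hy.1 hxy
    refine ⟨g • b, ⟨hinv g b hb, _, hg, hG.smul_mem_cut g hx, hG.smul_mem_cut g hy,
      fun c hc hbc hcut => ?_⟩, MulAction.orbit_eq_iff.2 (MulAction.mem_orbit b g)⟩
    refine hout (g⁻¹ • c) (hinv _ _ hc) ?_ ⟨?_, ?_⟩
    · rw [Set.ssubset_iff_subset_ne] at hbc ⊢
      refine ⟨?_, fun h => hbc.2 (by rw [h, smul_inv_smul])⟩
      rw [Set.subset_smul_set_iff, inv_inv]
      exact hbc.1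
    · simpa using hG.smul_mem_cut g⁻¹ hcut.1
    · simpa using hG.smul_mem_cut g⁻¹ hcut.2
  refine (Set.encard_le_encard hT).trans ((Set.encard_image_le _ _).trans ?_)
  rcases T.eq_empty_or_nonempty with h | ⟨b₁, hb₁⟩
  · simp [h]
  have : Nonempty (X × X) := ⟨hb₁.2.choose⟩
  choose! p hpP hp using fun b (hb : b ∈ T) => hb.2
  refine Set.encard_le_encard_of_injOn (f := fun b => (p b, Γ.s (p b).1 ∈ b))
    (fun b hb => ⟨hpP b hb, trivial⟩) fun b hb c hc hbc => ?_
  obtain ⟨hpbc, hside⟩ := Prod.mk.inj hbc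
  obtain ⟨hb₁, hb₂, hb₃⟩ := hp b hb
  obtain ⟨hc₁, hc₂, hc₃⟩ := hp c hc
  rw [← hpbc] at hc₁ hc₂ hc₃ hside
  have h₁ := hb₁.2
  have h₂ := hc₁.2
  have hcomp : b ⊆ c ∨ c ⊆ b := by
    by_cases hs : Γ.s (p b).1 ∈ b
    · have hs' : Γ.s (p b).1 ∈ c := by rwa [← hside]
      exact (hnest b hb.1 c hc.1).subset_or_subset (v := Γ.t (p b).1) hs hs' (by tauto) (by tauto)
    · have hs' : Γ.s (p b).1 ∉ c := by rwa [← hside]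
      exact (hnest b hb.1 c hc.1).subset_or_subset (u := Γ.t (p b).1) (by tauto) (by tauto) hs hs'
  by_contra hne
  rcases hcomp with h | h
  · exact hb₃ c hc.1 (h.ssubset_of_ne hne) ⟨hc₁, hc₂⟩
  · exact hc₃ b hb.1 (h.ssubset_of_ne (Ne.symm hne)) ⟨hb₁, hb₂⟩

/-- An invariant nested family of thin sets consists of finitely many orbits. -/
theorem finite_orbits (hΓ : Γ.Splits) (hG : Γ.IsCocompact G) {E : Set (Set V)}
    (hinv : ∀ g : G, ∀ b ∈ E, g • b ∈ E) (hthin : ∀ b ∈ E, Γ.Thin b)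
    (hnest : ∀ a ∈ E, ∀ b ∈ E, NestedPair a b) :
    ((fun b : Set V => MulAction.orbit G b) '' E).Finite := by
  obtain ⟨P, hPfin, hP⟩ := hG.finite_pairs
  have hTfin : (P ×ˢ (Set.univ : Set Prop)).Finite := hPfin.prod (Set.toFinite _)
  by_contra hinf
  obtain ⟨t, ht, htcard⟩ := Set.Infinite.exists_subset_card_eq hinf
    ((P ×ˢ (Set.univ : Set Prop)).ncard + 1)
  choose! f hfE hf using fun o (ho : o ∈ t) => ht ho
  let n := t.sup fun o => (Γ.cut (f o)).ncard
  have hle := encard_orbits_le (Γ := Γ) (G := G) (E := {b ∈ E | (Γ.cut b).ncard ≤ n}) (n := n)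
    (fun g b hb => ⟨hinv g b hb.1, (hG.ncard_cut_smul g b).trans_le hb.2⟩) hG
    (fun b hb => ⟨(hthin b hb.1).isTrack hΓ, (hthin b hb.1).finite, (hthin b hb.1).cut_nonempty,
      hb.2⟩) (fun a ha b hb => hnest a ha.1 b hb.1) hP
  have hsub : (t : Set (Set (Set V))) ⊆
      (fun b : Set V => MulAction.orbit G b) '' {b ∈ E | (Γ.cut b).ncard ≤ n} :=
    fun o ho => ⟨f o, ⟨hfE o ho, Finset.le_sup (f := fun o => (Γ.cut (f o)).ncard) ho⟩, hf o ho⟩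
  have := (Set.encard_le_encard hsub).trans hle
  rw [Set.encard_coe_eq_coe_finsetCard, htcard, ← hTfin.cast_ncard_eq] at this
  have := ENat.natCast_le_natCast.1 this
  omega

/-- The sets with a finite cut are generated additively by an invariant nested family of thin
sets with finitely many orbits: by a maximal one. -/
theorem exists_nested_generating (hΓ : Γ.Splits) (hG : Γ.IsCocompact G) :
    ∃ E : Set (Set V), (∀ b ∈ E, (Γ.cut b).Finite) ∧ (∀ g : G, ∀ b ∈ E, g • b ∈ E) ∧
      NestedFamily E ∧ ((fun b : Set V => MulAction.orbit G b) '' E).Finite ∧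
      ∀ b, (Γ.cut b).Finite → b ∈ additiveSpan (insert Set.univ E) := by
  obtain ⟨E, ⟨hinv, hnest, hthin⟩, hmax⟩ := zorn_subset
    {E : Set (Set V) | (∀ g : G, ∀ b ∈ E, g • b ∈ E) ∧ NestedFamily E ∧ ∀ b ∈ E, Γ.Thin b} <| by
    intro c hc hchain
    refine ⟨⋃₀ c, ⟨?_, ⟨?_, ?_⟩, ?_⟩, fun E hE => Set.subset_sUnion_of_mem hE⟩
    · rintro g b ⟨E, hE, hb⟩
      exact ⟨E, hE, (hc hE).1 g b hb⟩
    · rintro b ⟨E, hE, hb⟩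
      exact ⟨E, hE, (hc hE).2.1.1 b hb⟩
    · rintro a ⟨E, hE, ha⟩ b ⟨E', hE', hb⟩
      rcases hchain.total hE hE' with h | h
      · exact (hc hE').2.1.2 a (h ha) b hb
      · exact (hc hE).2.1.2 a ha b (h hb)
    · rintro b ⟨E, hE, hb⟩
      exact (hc hE).2.2 b hb
  have hfin := finite_orbits hΓ hG hinv hthin hnest.2
  refine ⟨E, fun b hb => (hthin b hb).finite, hinv, hnest, hfin, ?_⟩
  by_contra! hex
  have hbound : ∃ n, ∀ e ∈ E, (Γ.cut e).ncard ≤ n := by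
    choose! f hfE hf using fun o (ho : o ∈ (fun b : Set V => MulAction.orbit G b) '' E) => ho
    refine ⟨hfin.toFinset.sup fun o => (Γ.cut (f o)).ncard, fun e he => ?_⟩
    have ho : MulAction.orbit G e ∈ (fun b : Set V => MulAction.orbit G b) '' E := ⟨e, he, rfl⟩
    obtain ⟨g, hg⟩ := MulAction.orbit_eq_iff.1 (hf _ ho).symm
    have hg' : g • f (MulAction.orbit G e) = e := hg
    refine le_trans (le_of_eq ?_) (Finset.le_sup (f := fun o => (Γ.cut (f o)).ncard)
      (hfin.mem_toFinset.2 ho))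
    rw [← hG.ncard_cut_smul g (f _), hg']
  obtain ⟨n, hn⟩ := hbound
  have hER : E ⊆ additiveSpan (insert Set.univ E) :=
    (Set.subset_insert _ _).trans (subset_additiveSpan _)
  obtain ⟨b, hbthin, hbR, hbE, hbG⟩ := exists_nested_orbit hΓ hG hinv hthin hn hnest.2
    (additiveFamily_additiveSpan _)
    ⟨Set.univ, subset_additiveSpan _ (Set.mem_insert _ _)⟩ hER
    (fun g a ha => smul_mem_additiveSpan (fun g a ha => ha.elim
      (fun h => by rw [h, Set.smul_set_univ]; exact Set.mem_insert _ _)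
      fun h => .inr (hinv g a h)) g ha) hex
  let O : Set (Set V) := {a | ∃ g : G, a = g • b ∨ a = (g • b)ᶜ}
  have hOE : ∀ a ∈ O, ∀ e ∈ E, NestedPair e a := by
    rintro a ⟨g, ha⟩ e he
    rw [nestedPair_iff_of_eq_or ha, ← nestedPair_smul g⁻¹, inv_smul_smul]
    exact hbE _ (hinv _ _ he)
  have hOO : ∀ a ∈ O, ∀ a' ∈ O, NestedPair a a' := by
    rintro a ⟨g, ha⟩ a' ⟨g', ha'⟩
    rw [nestedPair_iff_of_eq_or ha']
    refine NestedPair.symm ?_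
    rw [nestedPair_iff_of_eq_or ha, ← nestedPair_smul g'⁻¹, inv_smul_smul, smul_smul]
    exact hbG _
  have hbO : b ∈ E := by
    refine hmax (y := E ∪ O) ⟨?_, ⟨?_, ?_⟩, ?_⟩ Set.subset_union_left
      (.inr ⟨1, .inl (one_smul G b).symm⟩)
    · rintro g a (ha | ⟨h, rfl | rfl⟩)
      · exact .inl (hinv g a ha)
      · exact .inr ⟨g * h, .inl (smul_smul g h b)⟩
      · exact .inr ⟨g * h, .inr (by rw [Set.smul_set_compl, smul_smul])⟩
    · rintro a (ha | ⟨h, rfl | rfl⟩)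
      · exact .inl (hnest.1 a ha)
      · exact .inr ⟨h, .inr rfl⟩
      · exact .inr ⟨h, .inl (compl_compl _)⟩
    · rintro a (ha | ha) a' (ha' | ha')
      · exact hnest.2 a ha a' ha'
      · exact hOE a' ha' a ha
      · exact (hOE a ha a' ha').symm
      · exact hOO a ha a' ha'
    · rintro a (ha | ⟨h, rfl | rfl⟩)
      · exact hthin a ha
      · exact hbthin.smul hG h
      · exact (hbthin.smul hG h).compl
  exact hbR (hER hbO)

end TriGraph

namespace PolyComplex

variable {V D F : Type*} (K : PolyComplex V D F)

/-! ### The triangulated graph of a polyhedral complex -/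

/-- The vertices of a 1-cell or a 2-cell. -/
def cellVerts : D ⊕ F → Set V
  | .inl d => {K.src d, K.tgt d}
  | .inr σ => {v | ∃ d ∈ K.bd σ, K.src d = v}

/-- Two cells of dimension one or two are incident if one is a face of the other, or if they are
the same cell up to orientation. -/
def Incident : D ⊕ F → D ⊕ F → Prop
  | .inl d, .inl e => e = d ∨ e = K.rev d
  | .inl d, .inr σ => d ∈ K.bd σ ∨ K.rev d ∈ K.bd σ
  | .inr σ, .inl d => d ∈ K.bd σ ∨ K.rev d ∈ K.bd σ
  | .inr σ, .inr τ => τ = σ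

theorem tgt_rev (d : D) : K.tgt (K.rev d) = K.src d := by
  simp [tgt, K.rev_rev]

theorem finite_mem_cycle {α : Type*} (c : Cycle α) : {a | a ∈ c}.Finite := by
  induction c using Quotient.inductionOn with
  | h l => exact l.finite_toSet

theorem mem_of_mem_toMultiset {α : Type*} {c : Cycle α} {a : α} (h : a ∈ c.toMultiset) :
    a ∈ c := by
  induction c using Quotient.inductionOn with
  | h l => exact h

theorem finite_cellVerts (i : D ⊕ F) : (K.cellVerts i).Finite := by
  rcases i with d | σ
  · exact Set.toFinite {K.src d, K.tgt d}
  · exact (finite_mem_cycle (K.bd σ)).image K.src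

theorem tgts_eq_srcs (σ : F) :
    {v | ∃ d ∈ K.bd σ, K.tgt d = v} = {v | ∃ d ∈ K.bd σ, K.src d = v} := by
  have hc := K.bd_closed σ
  generalize K.bd σ = c at hc
  induction c using Quotient.inductionOn with
  | h l =>
    cases l with
    | nil =>
      ext v
      exact iff_of_false (fun ⟨d, hd, _⟩ => Cycle.notMem_nil d hd)
        fun ⟨d, hd, _⟩ => Cycle.notMem_nil d hd
    | cons a l =>
      have h := K.map_tgt_eq_map_src l a a ((Cycle.chain_coe_cons _ a l).1 hc)
      ext v
      have h' : v ∈ (a :: l).map K.tgt ↔ v ∈ (l ++ [a]).map K.src := by rw [h]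
      simp only [List.mem_map, List.mem_append, List.mem_singleton] at h'
      change (∃ d ∈ a :: l, K.tgt d = v) ↔ ∃ d ∈ a :: l, K.src d = v
      rw [h']
      simp only [List.mem_cons, or_comm]

theorem tgt_mem_cellVerts {σ : F} {d : D} (hd : d ∈ K.bd σ) : K.tgt d ∈ K.cellVerts (.inr σ) :=
  (K.tgts_eq_srcs σ).le ⟨d, hd, rfl⟩

theorem src_mem_cellVerts {σ : F} {d : D} (hd : d ∈ K.bd σ) : K.src d ∈ K.cellVerts (.inr σ) :=
  ⟨d, hd, rfl⟩

/-- A set that separates no edge on the boundary of a 2-cell separates no vertices of it. -/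
theorem mem_iff_mem_of_forall_bd {σ : F} {b : Set V}
    (h : ∀ d ∈ K.bd σ, K.src d ∈ b ↔ K.tgt d ∈ b) {u v : V} (hu : u ∈ K.cellVerts (.inr σ))
    (hv : v ∈ K.cellVerts (.inr σ)) : u ∈ b ↔ v ∈ b := by
  have key : ∀ (l : List D) (a : D),
      List.IsChain (fun d e => K.src (K.rev d) = K.src e) (a :: l) →
      (∀ d ∈ a :: l, K.src d ∈ b ↔ K.tgt d ∈ b) → ∀ e ∈ a :: l, K.src e ∈ b ↔ K.src a ∈ b := by
    intro l
    induction l with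
    | nil => intro a _ _ e he; rw [List.mem_singleton.1 he]
    | cons c l ih =>
      intro a hch hall e he
      rw [List.isChain_cons_cons] at hch
      rcases List.mem_cons.1 he with rfl | he
      · rfl
      · rw [ih c hch.2 (fun d hd => hall d (.tail _ hd)) e he, ← hch.1]
        exact (hall a (.head _)).symm
  obtain ⟨d, hd, rfl⟩ := hu
  obtain ⟨e, he, rfl⟩ := hv
  have hc := K.bd_closed σ
  generalize K.bd σ = c at hc h hd he
  induction c using Quotient.inductionOn with
  | h l =>
    cases l with
    | nil => exact absurd hd (Cycle.notMem_nil d)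
    | cons a l =>
      have hch := (Cycle.chain_coe_cons _ a l).1 hc
      rw [← List.cons_append] at hch
      have hch' := hch.left_of_append
      rw [key l a hch' h d hd, key l a hch' h e he]

/-- The graph on `V` in which any two vertices of a cell are joined by an edge that belongs to this
cell. An edge is a triple of a cell and its two endpoints; the three edges between three vertices
of a cell form a triangle, and an edge of a 2-cell is also linked to the same edge of an incident
1-cell. -/
def triGraph (hconn : K.Connected) (hfin : K.LocallyFiniteAwayFromVertices) :
    TriGraph V ((D ⊕ F) × V × V) where
  edges := {x | x.2.1 ∈ K.cellVerts x.1 ∧ x.2.2 ∈ K.cellVerts x.1}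
  s x := x.2.1
  t x := x.2.2
  rel x y := (x.1 = y.1 ∧ x.2.1 = y.2.1) ∨ (x.1 = y.1 ∧ x.2.1 = y.2.2 ∧ x.2.2 = y.2.1) ∨
    (K.Incident x.1 y.1 ∧ x.2 = y.2)
  rel_refl x _ := .inl ⟨rfl, rfl⟩
  rel_cases := by
    rintro ⟨i, u, v⟩ ⟨-, hv⟩ ⟨j, u', v'⟩ ⟨-, hv'⟩ h
    rcases h with ⟨h₁, h₂⟩ | ⟨-, h₂⟩ | ⟨-, h₂⟩
    · obtain rfl : i = j := h₁
      exact .inr ⟨h₂, (i, v, v'), ⟨hv, hv'⟩, rfl, rfl⟩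
    · exact .inl h₂
    · obtain ⟨rfl, rfl⟩ := Prod.mk.inj h₂
      exact .inr ⟨rfl, (i, v, v), ⟨hv, hv⟩, rfl, rfl⟩
  finite_rel := by
    rintro ⟨i, u, v⟩ -
    have hJ : {j | K.Incident i j}.Finite := by
      rcases i with d | σ
      · refine ((Set.toFinite {(.inl d : D ⊕ F), .inl (K.rev d)}).union
          ((hfin d).image Sum.inr)).subset ?_
        rintro (e | τ) h
        · exact .inl (h.imp (congrArg _) (congrArg _))
        · exact .inr ⟨τ, h, rfl⟩
      · refine (((finite_mem_cycle (K.bd σ)).union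
          ((finite_mem_cycle (K.bd σ)).image K.rev)).image Sum.inl |>.union
            (Set.finite_singleton (.inr σ))).subset ?_
        rintro (e | τ) h
        · refine .inl ⟨e, h.imp id fun h' => ⟨K.rev e, h', K.rev_rev e⟩, rfl⟩
        · exact .inr (congrArg Sum.inr h)
    have hS := K.finite_cellVerts i
    refine (((Set.finite_singleton i).prod (hS.prod hS)).union
      (hJ.prod (Set.finite_singleton (u, v)))).subset ?_
    rintro ⟨j, u', v'⟩ ⟨hy, ⟨rfl, -⟩ | ⟨rfl, -⟩ | ⟨h, h'⟩⟩
    · exact .inl ⟨rfl, hy⟩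
    · exact .inl ⟨rfl, hy⟩
    · exact .inr ⟨h, h'.symm⟩
  connected := by
    intro b hb
    have hstep : ∀ d, K.src d ∈ b ↔ K.tgt d ∈ b := fun d =>
      hb (.inl d, K.src d, K.tgt d) ⟨.inl rfl, .inr rfl⟩
    have hall : ∀ u v, u ∈ b ↔ v ∈ b := by
      intro u v
      induction hconn.2 u v with
      | refl => rfl
      | tail _ h ih =>
        obtain ⟨d, rfl, rfl⟩ := h
        exact ih.trans (hstep d)
    rcases b.eq_empty_or_nonempty with h | ⟨u, hu⟩
    · exact .inl h
    · exact .inr (Set.eq_univ_of_forall fun v => (hall u v).1 hu)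

variable {K} (hconn : K.Connected) (hfin : K.LocallyFiniteAwayFromVertices)

theorem inl_mem_cut_iff {b : Set V} {d : D} :
    (.inl d, K.src d, K.tgt d) ∈ (K.triGraph hconn hfin).cut b ↔ d ∈ K.coboundary b :=
  ⟨fun h => h.2, fun h => ⟨⟨.inl rfl, .inr rfl⟩, h⟩⟩

theorem finite_cut_iff {b : Set V} :
    ((K.triGraph hconn hfin).cut b).Finite ↔ (K.coboundary b).Finite := by
  constructor
  · intro h
    refine Set.Finite.of_injOn (f := fun d => (.inl d, K.src d, K.tgt d))
      (fun d hd => (inl_mem_cut_iff hconn hfin).2 hd) (fun d _ e _ hde => ?_) h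
    exact Sum.inl_injective (Prod.mk.inj hde).1
  · intro h
    have hI : (Sum.inl '' K.coboundary b ∪ Sum.inr '' {σ | ∃ d ∈ K.bd σ, d ∈ K.coboundary b} :
        Set (D ⊕ F)).Finite := by
      refine (h.image _).union (Set.Finite.image _ ?_)
      refine (h.biUnion fun d _ => hfin d).subset ?_
      rintro σ ⟨d, hd, hdb⟩
      exact Set.mem_biUnion hdb (.inl hd)
    refine (hI.biUnion fun i _ => (Set.finite_singleton i).prod
      ((K.finite_cellVerts i).prod (K.finite_cellVerts i))).subset ?_
    rintro ⟨i, u, v⟩ ⟨hx, huv⟩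
    refine Set.mem_biUnion (x := i) ?_ ⟨rfl, hx⟩
    rcases i with d | σ
    · refine .inl ⟨d, fun hd => huv ?_, rfl⟩
      change u ∈ b ↔ v ∈ b
      obtain ⟨rfl | rfl, rfl | rfl⟩ := hx <;> tauto
    · refine .inr ⟨σ, ?_, rfl⟩
      by_contra hcon
      refine huv (K.mem_iff_mem_of_forall_bd (fun d hd => ?_) hx.1 hx.2)
      by_contra h
      exact hcon ⟨d, hd, h⟩

/-- Under cohomological planarity, a finite set of edges is a coboundary if its trace on the
boundary of each 2-cell is that of a coboundary, since its indicator function is then a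
cocycle. -/
theorem CHomP.exists_coboundary_eq (hchomp : K.CHomP) {B : Set D} (hB : B.Finite)
    (hrev : ∀ d ∈ B, K.rev d ∈ B)
    (hbd : ∀ σ, ∃ b, ∀ d ∈ K.bd σ, d ∈ B ↔ d ∈ K.coboundary b) : ∃ a, K.coboundary a = B := by
  classical
  have hrev' : ∀ d, K.rev d ∈ B ↔ d ∈ B := fun d =>
    ⟨fun h => by simpa only [K.rev_rev] using hrev _ h, hrev d⟩
  let z : K.C1 := ⟨fun d => if d ∈ B then 1 else 0, fun d => by simp only [hrev']⟩
  have hz : ∀ d, z.1 d = if d ∈ B then 1 else 0 := fun _ => rfl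
  let χ : Set V → V → ZMod 2 := fun c v => if v ∈ c then 1 else 0
  have hχ : ∀ c d, (K.d0 (χ c)).1 d = if d ∈ K.coboundary c then 1 else 0 := by
    intro c d
    rw [d0_apply]
    by_cases h₁ : K.src d ∈ c <;> by_cases h₂ : K.tgt d ∈ c <;>
      simp [χ, coboundary, h₁, h₂, CharTwo.add_self_eq_zero]
  have hzc : z ∈ K.Z1c := by
    refine ⟨?_, hB.subset fun d hd => ?_⟩
    · refine LinearMap.mem_ker.2 (funext fun σ => ?_)
      obtain ⟨b, hb⟩ := hbd σ
      rw [← K.d1_d0 (χ b), d1_apply, d1_apply]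
      refine congrArg _ (Multiset.map_congr rfl fun d hd => ?_)
      rw [hz, hχ]
      exact if_congr (hb d (mem_of_mem_toMultiset hd)) rfl rfl
    · by_contra h
      exact hd ((hz d).trans (if_neg h))
  obtain ⟨f, hf⟩ := K.cHomP_iff.1 hchomp z hzc
  have hfa : f = χ {v | f v = 1} := by
    ext v
    have : ∀ x : ZMod 2, x ≠ 1 → x = 0 := by decide
    by_cases h : f v = 1
    · simp [χ, h]
    · simp [χ, this _ h]
  refine ⟨{v | f v = 1}, Set.ext fun d => ?_⟩
  have h := hz d
  rw [← hf, hfa, hχ] at h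
  by_cases h₂ : d ∈ B
  · rw [if_pos h₂] at h
    exact iff_of_true (by by_contra h'; simp only [if_neg h', zero_ne_one] at h) h₂
  · rw [if_neg h₂] at h
    exact iff_of_false (fun h' => by simp only [if_pos h', one_ne_zero] at h) h₂

/-- Cohomological planarity says that unions of components of finite cuts are cuts. On each
2-cell such a union `A` consists of all edges of the cut, or of none. Hence the edges of `K` in `A`
form a cocycle, and a set with this coboundary has cut `A`. -/
theorem splits_triGraph (hchomp : K.CHomP) : (K.triGraph hconn hfin).Splits := by
  intro b hbf A hA hcl
  -- the three ways in which `A` is closed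
  have hflip : ∀ {i u v}, (i, u, v) ∈ A → (i, v, u) ∈ A := by
    intro i u v h
    refine hcl _ h _ ⟨⟨(hA h).1.2, (hA h).1.1⟩, fun h' => (hA h).2 h'.symm⟩ ?_
    exact .inr (.inl ⟨rfl, rfl, rfl⟩)
  have hface : ∀ {i u v v'}, (i, u, v) ∈ A → (i, u, v') ∈ (K.triGraph hconn hfin).cut b →
      (i, u, v') ∈ A := fun h h' => hcl _ h _ h' (.inl ⟨rfl, rfl⟩)
  have hinc : ∀ {i j u v}, (i, u, v) ∈ A → K.Incident i j → u ∈ K.cellVerts j →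
      v ∈ K.cellVerts j → (j, u, v) ∈ A := fun h hij hu hv =>
    hcl _ h _ ⟨⟨hu, hv⟩, (hA h).2⟩ (.inr (.inr ⟨hij, rfl⟩))
  -- on each cell, `A` contains all edges of the cut or none
  have hcell : ∀ i, (∀ u v, (i, u, v) ∉ A) ∨
      ∀ u v, (i, u, v) ∈ (K.triGraph hconn hfin).cut b → (i, u, v) ∈ A := by
    intro i
    by_contra! hcon
    obtain ⟨⟨u, v, huv⟩, u', v', hc, hn⟩ := hcon
    have key : ∀ u v u' v', (i, u, v) ∈ A → (i, u', v') ∈ (K.triGraph hconn hfin).cut b →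
        u ∈ b → u' ∈ b → (i, u', v') ∈ A := by
      intro u v u' v' h hc hu hu'
      have hv' : v' ∉ b := fun h' => hc.2 ⟨fun _ => h', fun _ => hu'⟩
      refine hflip (hface (hflip (hface h ⟨⟨(hA h).1.1, hc.1.2⟩, ?_⟩)) ⟨⟨hc.1.2, hc.1.1⟩, ?_⟩)
      · exact fun h' => hv' (h'.1 hu)
      · exact fun h' => hv' (h'.2 hu')
    have hc' : (i, v', u') ∈ (K.triGraph hconn hfin).cut b :=
      ⟨⟨hc.1.2, hc.1.1⟩, fun h' => hc.2 h'.symm⟩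
    have h₁ : ¬(u ∈ b ↔ v ∈ b) := (hA huv).2
    have h₂ : ¬(u' ∈ b ↔ v' ∈ b) := hc.2
    by_cases hu : u ∈ b <;> by_cases hu' : u' ∈ b
    · exact hn (key _ _ _ _ huv hc hu hu')
    · exact hn (hflip (key _ _ _ _ huv hc' hu (by tauto)))
    · exact hn (key _ _ _ _ (hflip huv) hc (by tauto) hu')
    · exact hn (hflip (key _ _ _ _ (hflip huv) hc' (by tauto) (by tauto)))
  have hrev : ∀ d, (.inl d, K.src d, K.tgt d) ∈ A →
      (.inl (K.rev d), K.src (K.rev d), K.tgt (K.rev d)) ∈ A := by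
    intro d h
    rw [K.tgt_rev]
    exact hflip (hinc h (.inr rfl) (.inr (K.tgt_rev d).symm) (.inl rfl))
  have hbd : ∀ {σ d}, d ∈ K.bd σ →
      ((.inl d, K.src d, K.tgt d) ∈ A ↔ (.inr σ, K.src d, K.tgt d) ∈ A) := fun hd =>
    ⟨fun h => hinc h (.inl hd) (K.src_mem_cellVerts hd) (K.tgt_mem_cellVerts hd),
      fun h => hinc h (.inl hd) (.inl rfl) (.inr rfl)⟩
  -- hence the edges of `K` in `A` form a coboundary
  obtain ⟨a, ha⟩ := hchomp.exists_coboundary_eq (B := {d | (Sum.inl d, K.src d, K.tgt d) ∈ A})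
    (((finite_cut_iff hconn hfin).1 hbf).subset fun d hd => (hA hd).2) hrev <| by
    intro σ
    rcases hcell (.inr σ) with h | h
    · exact ⟨∅, fun d hd => iff_of_false (fun h' => h _ _ ((hbd hd).1 h')) (by simp [coboundary])⟩
    · exact ⟨b, fun d hd => ⟨fun h' => (hA h').2, fun h' => (hbd hd).2
        (h _ _ ⟨⟨K.src_mem_cellVerts hd, K.tgt_mem_cellVerts hd⟩, h'⟩)⟩⟩
  have hacob : ∀ d, d ∈ K.coboundary a ↔ (.inl d, K.src d, K.tgt d) ∈ A := fun d => by
    rw [ha]; rfl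
  refine ⟨a, Set.ext fun ⟨i, u, v⟩ => ?_⟩
  rcases i with d | σ
  · have hd := hacob d
    constructor
    · rintro ⟨hx, huv⟩
      have huv' : ¬(u ∈ a ↔ v ∈ a) := huv
      obtain ⟨rfl | rfl, rfl | rfl⟩ := hx
      · tauto
      · exact hd.1 huv'
      · exact hflip (hd.1 fun h => huv' h.symm)
      · tauto
    · intro h
      have hx := (hA h).1
      have huv : ¬(u ∈ b ↔ v ∈ b) := (hA h).2
      refine ⟨hx, ?_⟩
      obtain ⟨rfl | rfl, rfl | rfl⟩ := hx
      · tauto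
      · exact hd.2 h
      · exact fun h' => hd.2 (hflip h) h'.symm
      · tauto
  · rcases hcell (.inr σ) with h | h
    · refine iff_of_false (fun hx => ?_) (h u v)
      refine hx.2 (K.mem_iff_mem_of_forall_bd (fun d hd => ?_) hx.1.1 hx.1.2)
      by_contra hcon
      exact h _ _ ((hbd hd).1 ((hacob d).1 hcon))
    · -- here `a` and `b` separate the same boundary edges, so their sum separates none
      have hsame : ∀ d ∈ K.bd σ,
          K.src d ∈ symmDiff a b ↔ K.tgt d ∈ symmDiff a b := by
        intro d hd
        have h₁ : ¬(K.src d ∈ a ↔ K.tgt d ∈ a) ↔ ¬(K.src d ∈ b ↔ K.tgt d ∈ b) :=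
          (hacob d).trans ⟨fun h' => (hA h').2, fun h' => (hbd hd).2
            (h _ _ ⟨⟨K.src_mem_cellVerts hd, K.tgt_mem_cellVerts hd⟩, h'⟩)⟩
        simp only [Set.mem_symmDiff]
        tauto
      have hab : u ∈ K.cellVerts (.inr σ) → v ∈ K.cellVerts (.inr σ) →
          (¬(u ∈ a ↔ v ∈ a) ↔ ¬(u ∈ b ↔ v ∈ b)) := fun hu hv => by
        have := K.mem_iff_mem_of_forall_bd hsame hu hv
        simp only [Set.mem_symmDiff] at this
        tauto
      exact ⟨fun hx => h u v ⟨hx.1, (hab hx.1.1 hx.1.2).1 hx.2⟩,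
        fun hx => ⟨(hA hx).1, (hab (hA hx).1.1 (hA hx).1.2).2 (hA hx).2⟩⟩

/-! ### The group action -/

variable {G : Type*} [Group G] [MulAction G V] [MulAction G D] [MulAction G F]

theorem IsCellularAction.tgt_smul (hact : K.IsCellularAction G) (g : G) (d : D) :
    K.tgt (g • d) = g • K.tgt d := by
  rw [tgt, hact.rev_smul, hact.src_smul, tgt]

theorem IsCellularAction.smul_mem_bd (hact : K.IsCellularAction G) (g : G) {σ : F} {d : D}
    (hd : d ∈ K.bd σ) : g • d ∈ K.bd (g • σ) ∨ K.rev (g • d) ∈ K.bd (g • σ) := by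
  rcases hact.bd_smul g σ with h | h <;> rw [h]
  · exact .inl (Cycle.mem_map.2 ⟨d, hd, rfl⟩)
  · exact .inr (Cycle.mem_reverse_iff.2 (Cycle.mem_map.2 ⟨d, hd, rfl⟩))

theorem IsCellularAction.smul_mem_cellVerts (hact : K.IsCellularAction G) (g : G) {i : D ⊕ F}
    {v : V} (hv : v ∈ K.cellVerts i) : g • v ∈ K.cellVerts (g • i) := by
  rcases i with d | σ
  · rcases hv with rfl | rfl
    · exact .inl (hact.src_smul g d).symm
    · exact .inr (hact.tgt_smul g d).symm
  · obtain ⟨d, hd, rfl⟩ := hv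
    rcases hact.smul_mem_bd g hd with h | h
    · exact ⟨_, h, hact.src_smul g d⟩
    · rw [← hact.src_smul, ← K.tgt_rev]
      exact K.tgt_mem_cellVerts h

theorem IsCellularAction.incident_smul (hact : K.IsCellularAction G) (g : G) {i j : D ⊕ F}
    (h : K.Incident i j) : K.Incident (g • i) (g • j) := by
  have key : ∀ {d : D} {σ : F}, d ∈ K.bd σ ∨ K.rev d ∈ K.bd σ →
      g • d ∈ K.bd (g • σ) ∨ K.rev (g • d) ∈ K.bd (g • σ) := by
    rintro d σ (h | h)
    · exact hact.smul_mem_bd g h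
    · have := hact.smul_mem_bd g h
      rw [hact.rev_smul, K.rev_rev, ← hact.rev_smul] at this
      exact this.symm
  rcases i with d | σ <;> rcases j with e | τ
  · refine h.imp (congrArg _) fun h => ?_
    rw [h, hact.rev_smul]
  · exact key h
  · exact key h
  · exact congrArg (g • ·) h

theorem exists_finite_orbit_representatives (G : Type*) [Group G] (α : Type*) [MulAction G α]
    [Finite (MulAction.orbitRel.Quotient G α)] :
    ∃ S : Set α, S.Finite ∧ ∀ a, ∃ g : G, g • a ∈ S := by
  refine ⟨Set.range (Quotient.out : MulAction.orbitRel.Quotient G α → α), Set.finite_range _,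
    fun a => ?_⟩
  obtain ⟨g, hg⟩ := MulAction.orbitRel_apply.1
    (Quotient.mk_out (s := MulAction.orbitRel G α) a)
  exact ⟨g, _, hg.symm⟩

theorem isCocompact_triGraph (hact : K.IsCellularAction G)
    (hcoc : IsCocompactAction V D F G) : (K.triGraph hconn hfin).IsCocompact G := by
  have hedges : ∀ (g : G), ∀ x ∈ (K.triGraph hconn hfin).edges,
      g • x ∈ (K.triGraph hconn hfin).edges := fun g x hx =>
    ⟨hact.smul_mem_cellVerts g hx.1, hact.smul_mem_cellVerts g hx.2⟩
  refine ⟨fun _ _ => rfl, fun _ _ => rfl, hedges, ?_⟩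
  have := hcoc.edges
  have := hcoc.faces
  obtain ⟨SD, hSD, hD⟩ := exists_finite_orbit_representatives G D
  obtain ⟨SF, hSF, hF⟩ := exists_finite_orbit_representatives G F
  let I : Set (D ⊕ F) := Sum.inl '' SD ∪ Sum.inr '' SF
  have hI : I.Finite := (hSD.image _).union (hSF.image _)
  have hrep : ∀ i : D ⊕ F, ∃ g : G, g • i ∈ I := by
    rintro (d | σ)
    · obtain ⟨g, hg⟩ := hD d
      exact ⟨g, .inl ⟨_, hg, rfl⟩⟩
    · obtain ⟨g, hg⟩ := hF σ
      exact ⟨g, .inr ⟨_, hg, rfl⟩⟩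
  have hX : {x ∈ (K.triGraph hconn hfin).edges | x.1 ∈ I}.Finite := by
    refine (hI.biUnion fun i _ => (Set.finite_singleton i).prod
      ((K.finite_cellVerts i).prod (K.finite_cellVerts i))).subset ?_
    rintro ⟨i, u, v⟩ ⟨hx, hi⟩
    exact Set.mem_biUnion (x := i) hi ⟨rfl, hx⟩
  refine ⟨_, hX.biUnion fun x hx => (Set.finite_singleton x).prod
    ((K.triGraph hconn hfin).finite_rel x hx.1), fun x hx y hy hxy => ?_⟩
  obtain ⟨g, hg⟩ := hrep x.1
  refine ⟨g, Set.mem_biUnion (x := g • x) ⟨hedges g x hx, hg⟩ ⟨rfl, hedges g y hy, ?_⟩⟩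
  rcases hxy with ⟨h₁, h₂⟩ | ⟨h₁, h₂, h₃⟩ | ⟨h₁, h₂⟩
  · exact .inl ⟨congrArg (g • ·) h₁, congrArg (g • ·) h₂⟩
  · exact .inr (.inl ⟨congrArg (g • ·) h₁, congrArg (g • ·) h₂, congrArg (g • ·) h₃⟩)
  · exact .inr (.inr ⟨hact.incident_smul g h₁, congrArg (g • ·) h₂⟩)

end PolyComplex

/-! ### Generators of the cut ring -/

theorem additiveFamily_closure {V : Type*} (E : Set (Set V)) :
    AdditiveFamily {b | toBoolRing b ∈ Subring.closure (toBoolRing '' E)} where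
  symmDiff_mem _ ha _ hb := by
    simpa only [Set.mem_ofPred_eq, toBoolRing_symmDiff] using add_mem ha hb
  compl_mem a ha := by
    have h : aᶜ = symmDiff Set.univ a := by
      ext x; simp [Set.mem_symmDiff]
    rw [Set.mem_ofPred_eq, h, toBoolRing_symmDiff]
    exact add_mem (one_mem (Subring.closure (toBoolRing '' E))) ha

theorem mainTheorem6 {V D F G : Type*} (K : PolyComplex V D F)
    [Group G] [MulAction G V] [MulAction G D] [MulAction G F]
    (hconn : K.Connected) (hfin : K.LocallyFiniteAwayFromVertices)
    (hact : K.IsCellularAction G) (hcoc : PolyComplex.IsCocompactAction V D F G)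
    (hchomp : K.CHomP) :
    ∃ E : Set (Set V),
      (∀ b ∈ E, toBoolRing b ∈ K.cutRing) ∧
      (∀ (g : G), ∀ b ∈ E, g • b ∈ E) ∧
      NestedFamily E ∧
      ((fun b : Set V => MulAction.orbit G b) '' E).Finite ∧
      Subring.closure (toBoolRing '' E) = K.cutRing := by
  obtain ⟨E, hE, hinv, hnest, horb, hgen⟩ := TriGraph.exists_nested_generating
    (PolyComplex.splits_triGraph hconn hfin hchomp)
    (PolyComplex.isCocompact_triGraph hconn hfin hact hcoc)
  have hcut : ∀ b ∈ E, toBoolRing b ∈ K.cutRing := fun b hb =>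
    (PolyComplex.finite_cut_iff hconn hfin).1 (hE b hb)
  refine ⟨E, hcut, hinv, hnest, horb, le_antisymm ?_ fun b hb => ?_⟩
  · rw [Subring.closure_le]
    rintro _ ⟨b, hb, rfl⟩
    exact hcut b hb
  · refine additiveSpan_subset (additiveFamily_closure E) ?_
      (hgen (ofBoolRing b) ((PolyComplex.finite_cut_iff hconn hfin).2 hb))
    rintro c (rfl | hc)
    · change (1 : AsBoolRing (Set V)) ∈ Subring.closure (toBoolRing '' E)
      exact one_mem _
    · change toBoolRing c ∈ Subring.closure (toBoolRing '' E)
      exact Subring.subset_closure (Set.mem_image_of_mem toBoolRing hc)
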